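/- Let $\Gamma$ be a finite quiver with vertex set $Q$ (finitely many vertices and arrows). For a finite field $F$ and a dimension vector $\alpha\in\mathbb N^{Q}$ let $m_\alpha(F)$ be the number of isomorphism classes of representations of $\Gamma$ over $F$ of dimension $\alpha$, and let $a_\alpha(F)$ be the number of isomorphism classes of those that are absolutely indecomposable (that is, indecomposable after extension of scalars to an algebraic closure of $F$; the zero representation is not indecomposable). Let $R$ be a commutative $\mathbb Q$-algebra that is a $\lambda$-ring, given by its Adams operations: ring endomorphisms $\psi_n$ ($n\ge1$) of $R$ with $\psi_1=\mathrm{id}$ and $\psi_m\psi_n=\psi_{mn}$. The power series ring $R[[x_i : i\in Q]]$ is a $\lambda$-ring with $\psi_n\big(\sum_\alpha f_\alpha x^\alpha\big)=\sum_\alpha\psi_n(f_\alpha)x^{n\alpha}$. For a power series $f$ with zero constant term, its plethystic exponential is $\mathrm{Exp}(f)=\sum_{n\ge0}\sigma_n(f)$, where $\sigma_n$ is the operation of the complete symmetric function $h_n$: $\sigma_0(f)=1$ and $n\,\sigma_n(f)=\sum_{k=1}^n\psi_k(f)\,\sigma_{n-k}(f)$. (Equivalently, $\mathrm{Exp}(f)=\exp\big(\sum_{k\ge1}\psi_k(f)/k\big)$.)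 (1) Let $p$ be a prime. Regard $m_\alpha$ and $a_\alpha$ as the functions $n\mapsto m_\alpha(\mathbb F_{p^n})$ and $n\mapsto a_\alpha(\mathbb F_{p^n})$ in the $\lambda$-ring of all functions $\{1,2,\dots\}\to\mathbb Q$ with Adams operations $(\psi_kf)(n)=f(kn)$, and put $m=\sum_\alpha m_\alpha x^\alpha$, $a=\sum_\alpha a_\alpha x^\alpha$. Then $a$ has zero constant term and $m=\mathrm{Exp}(a)$. (2) Let $m_\alpha(q),a_\alpha(q)\in\mathbb Q[q]$ be the polynomials with $m_\alpha(|F|)=m_\alpha(F)$ and $a_\alpha(|F|)=a_\alpha(F)$ for every finite field $F$ and every $\alpha$ (their existence is a theorem of Kac, which is not part of the claim). Put $m(q)=\sum_\alpha m_\alpha(q)x^\alpha$ and $a(q)=\sum_\alpha a_\alpha(q)x^\alpha$ in $\mathbb Q(q)[[x_i : i\in Q]]$, where $\mathbb Q(q)$ has the Adams operations $\psi_n(f(q))=f(q^n)$. Then $a(q)$ has zero constant term and $$m(q)=\mathrm{Exp}(a(q)).$$ -/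

import Mathlib

open Polynomial
open scoped nonZeroDivisors

universe u v w

/-! ### Representations of a quiver of fixed dimension vector -/

/-- Representations over `K` of dimension `α`, written in coordinates: an arrow `i ⟶ j` acts as a
linear map `K ^ α i → K ^ α j`, that is, as an `α j × α i` matrix. Every representation whose space
at `i` has dimension `α i` is isomorphic to one of these. -/
def QuiverRep (Q : Type u) [Quiver.{v} Q] (K : Type w) (α : Q → ℕ) : Type (max u v w) :=
  ∀ i j : Q, (i ⟶ j) → Matrix (Fin (α j)) (Fin (α i)) K

namespace QuiverRep

variable {Q : Type u} [Quiver.{v} Q] {K : Type w} [Field K] {α : Q → ℕ}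

/-- Isomorphism of representations: invertible linear maps at the vertices which commute with the
action of all arrows. -/
def Iso (M N : QuiverRep Q K α) : Prop :=
  ∃ g : ∀ i : Q, GL (Fin (α i)) K, ∀ (i j : Q) (e : i ⟶ j),
    (g j : Matrix (Fin (α j)) (Fin (α j)) K) * M i j e =
      N i j e * (g i : Matrix (Fin (α i)) (Fin (α i)) K)

theorem Iso.refl (M : QuiverRep Q K α) : Iso M M := ⟨fun _ => 1, by simp⟩

theorem Iso.symm {M N : QuiverRep Q K α} : Iso M N → Iso N M := by
  rintro ⟨g, hg⟩
  refine ⟨fun i => (g i)⁻¹, fun i j e => ?_⟩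
  have h1 : ((g j)⁻¹ : GL (Fin (α j)) K).val * (g j).val = 1 := by
    rw [← Units.val_mul]; simp
  have h2 : (g i).val * ((g i)⁻¹ : GL (Fin (α i)) K).val = 1 := by
    rw [← Units.val_mul]; simp
  calc ((g j)⁻¹ : GL (Fin (α j)) K).val * N i j e
      = ((g j)⁻¹ : GL (Fin (α j)) K).val * (N i j e * (g i).val) *
          ((g i)⁻¹ : GL (Fin (α i)) K).val := by
        rw [Matrix.mul_assoc, Matrix.mul_assoc, h2, Matrix.mul_one]
    _ = M i j e * ((g i)⁻¹ : GL (Fin (α i)) K).val := by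
        rw [← hg, ← Matrix.mul_assoc, h1, Matrix.one_mul]

theorem Iso.trans {M N P : QuiverRep Q K α} : Iso M N → Iso N P → Iso M P := by
  rintro ⟨g, hg⟩ ⟨h, hh⟩
  refine ⟨fun i => h i * g i, fun i j e => ?_⟩
  rw [Units.val_mul, Units.val_mul, Matrix.mul_assoc, hg, ← Matrix.mul_assoc, hh,
    Matrix.mul_assoc]

variable (Q K α) in
/-- Isomorphism as an equivalence relation on the representations of dimension `α`. -/
def isoSetoid : Setoid (QuiverRep Q K α) where
  r := Iso
  iseqv := ⟨Iso.refl, Iso.symm, Iso.trans⟩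

/-- A family of subspaces, one at each vertex, is a subrepresentation if it is stable under the
action of all arrows. -/
def IsSubrep (M : QuiverRep Q K α) (U : ∀ i : Q, Submodule K (Fin (α i) → K)) : Prop :=
  ∀ (i j : Q) (e : i ⟶ j), ∀ x ∈ U i, (M i j e).mulVec x ∈ U j

/-- A representation is indecomposable if it is nonzero and, whenever it is the internal direct sum
of two subrepresentations, one of the two is zero. -/
def IsIndecomposable (M : QuiverRep Q K α) : Prop :=
  (∃ i, α i ≠ 0) ∧
    ∀ U W : ∀ i : Q, Submodule K (Fin (α i) → K),
      M.IsSubrep U → M.IsSubrep W → (∀ i, IsCompl (U i) (W i)) →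
        (∀ i, U i = ⊥) ∨ (∀ i, W i = ⊥)

/-- Extension of scalars along a field extension `L / K`. -/
def baseChange (L : Type*) [Field L] [Algebra K L] (M : QuiverRep Q K α) : QuiverRep Q L α :=
  fun i j e => (M i j e).map (algebraMap K L)

/-- A representation is absolutely indecomposable if it stays indecomposable after extension of
scalars to an algebraic closure of the base field. -/
def IsAbsIndecomposable (M : QuiverRep Q K α) : Prop :=
  (M.baseChange (AlgebraicClosure K)).IsIndecomposable

variable (Q K α) in
/-- The number of isomorphism classes of representations of dimension `α` over `K`. -/
noncomputable def numReps : ℕ :=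
  Nat.card (Quotient (isoSetoid Q K α))

variable (Q K α) in
/-- The number of isomorphism classes of absolutely indecomposable representations of dimension
`α` over `K`. -/
noncomputable def numAbsIndec : ℕ :=
  Nat.card {c : Quotient (isoSetoid Q K α) //
    ∃ M : QuiverRep Q K α, Quotient.mk (isoSetoid Q K α) M = c ∧ M.IsAbsIndecomposable}

end QuiverRep

/-! ### Lambda-rings over the rationals and the plethystic exponential

On a commutative `ℚ`-algebra `R` a lambda-ring structure is the same as a family of Adams
operations: ring endomorphisms `ψ n`, `n ≥ 1`, with `ψ 1 = id` and `ψ (m n) = ψ m ∘ ψ n`, that is, a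
monoid homomorphism `ℕ+ →* (R →+* R)`. -/

namespace LambdaRing

/-- The operation `σ n` on `R` attached to the Adams operations `ψ`: the value at `a` of the complete
symmetric function `h n`, where the power sum `p k` takes the value `ψ k a`. It is given by the
Newton identities `n h n = ∑ k ∈ {1, …, n}, p k * h (n - k)`. -/
noncomputable def sigma {R : Type*} [CommRing R] [Algebra ℚ R] (ψ : ℕ+ →* (R →+* R)) (a : R) :
    ℕ → R
  | 0 => 1
  | n + 1 => ((n : ℚ) + 1)⁻¹ •
      ∑ k : Fin (n + 1), ψ (Nat.succPNat k) a * sigma ψ a (n - k)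
  decreasing_by omega

/-- The Adams operations on power series over `R`:
`ψ n (∑ f_α x^α) = ∑ ψ n (f_α) x^(n α)`. -/
noncomputable def adamsPowerSeries {ι R : Type*} [CommRing R] (ψ : ℕ+ →* (R →+* R)) :
    ℕ+ →* (MvPowerSeries ι R →+* MvPowerSeries ι R) where
  toFun n := (MvPowerSeries.map (ψ n)).comp
    (MvPowerSeries.expand (n : ℕ) n.ne_zero : MvPowerSeries ι R →ₐ[R] MvPowerSeries ι R)
  map_one' := by
    ext f d
    simp
  map_mul' m n := by
    refine RingHom.ext fun f => ?_
    simp only [RingHom.comp_apply, RingHom.coe_coe, RingHom.mul_def, map_mul]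
    rw [MvPowerSeries.map_expand (n : ℕ) n.ne_zero, ← MvPowerSeries.expand_mul]
    ext d
    simp [PNat.mul_coe, MvPowerSeries.map_expand]

/-- The plethystic exponential `Exp f = ∑ n ≥ 0, σ n f`, for a power series `f` without constant
term. In each degree only finitely many `σ n f` contribute, so the sum is taken coefficientwise. -/
noncomputable def plethExp {ι R : Type*} [CommRing R] [Algebra ℚ R] (ψ : ℕ+ →* (R →+* R))
    (f : MvPowerSeries ι R) : MvPowerSeries ι R :=
  fun d => ∑ᶠ n : ℕ, MvPowerSeries.coeff d (sigma (adamsPowerSeries ψ) f n)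

/-- The substitution `f(q) ↦ f(q^n)` on the field `ℚ(q)`. -/
noncomputable def ratFuncExpand (n : ℕ+) : RatFunc ℚ →+* RatFunc ℚ :=
  RatFunc.mapRingHom (expand ℚ (n : ℕ))
    (nonZeroDivisors_le_comap_nonZeroDivisors_of_injective _ (expand_injective n.pos))

theorem ratFuncExpand_algebraMap (n : ℕ+) (f : ℚ[X]) :
    ratFuncExpand n (algebraMap ℚ[X] (RatFunc ℚ) f) =
      algebraMap ℚ[X] (RatFunc ℚ) (expand ℚ (n : ℕ) f) := by
  have h := RatFunc.map_apply_div (expand ℚ (n : ℕ))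
    (nonZeroDivisors_le_comap_nonZeroDivisors_of_injective _ (expand_injective n.pos)) f 1
  rw [map_one, map_one, div_one, map_one, div_one] at h
  exact h

/-- The Adams operations on the field `ℚ(q)`: `ψ n (f(q)) = f(q^n)`. -/
noncomputable def adamsRatFunc : ℕ+ →* (RatFunc ℚ →+* RatFunc ℚ) where
  toFun := ratFuncExpand
  map_one' := by
    refine IsLocalization.ringHom_ext ℚ[X]⁰ (RingHom.ext fun f => ?_)
    simp [ratFuncExpand_algebraMap]
  map_mul' m n := by
    refine IsLocalization.ringHom_ext ℚ[X]⁰ (RingHom.ext fun f => ?_)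
    simp [ratFuncExpand_algebraMap, expand_mul]

/-- The Adams operations on functions of `n ≥ 1`, where `f n` is thought of as the value of a
counting function at the prime power `p^n`. Replacing `q = p^n` by `q^k = p^(k n)` gives
`(ψ k f) n = f (k n)`. -/
def adamsFun : ℕ+ →* ((ℕ+ → ℚ) →+* (ℕ+ → ℚ)) where
  toFun k :=
    { toFun := fun f n => f (k * n)
      map_one' := rfl
      map_mul' := fun _ _ => rfl
      map_zero' := rfl
      map_add' := fun _ _ => rfl }
  map_one' := by
    ext f n
    simp
  map_mul' k l := by
    ext f n
    simp [mul_comm, mul_left_comm]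

end LambdaRing

/-! ### Generating functions -/

/-- The generating function `∑ m_α x^α`, where the coefficient `m_α` is the function sending `n` to
the number of isomorphism classes of representations of dimension `α` over the field with `p^n`
elements. -/
noncomputable def repCountSeries (Q : Type u) [Quiver.{v} Q] (p : ℕ) [Fact p.Prime] :
    MvPowerSeries Q (ℕ+ → ℚ) :=
  fun α n => (QuiverRep.numReps Q (GaloisField p n) α : ℚ)

/-- The generating function `∑ a_α x^α`, where the coefficient `a_α` is the function sending `n` to
the number of isomorphism classes of absolutely indecomposable representations of dimension `α` over
the field with `p^n` elements. -/
noncomputable def absIndecCountSeries (Q : Type u) [Quiver.{v} Q] (p : ℕ) [Fact p.Prime] :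
    MvPowerSeries Q (ℕ+ → ℚ) :=
  fun α n => (QuiverRep.numAbsIndec Q (GaloisField p n) α : ℚ)

/-- The generating function `∑ P_α(q) x^α` in `ℚ(q)[[x]]` of a family of polynomials in `q`. -/
noncomputable def polySeries {Q : Type u} (P : (Q →₀ ℕ) → ℚ[X]) : MvPowerSeries Q (RatFunc ℚ) :=
  fun α => algebraMap ℚ[X] (RatFunc ℚ) (P α)

/-- `m_α(q)` is the polynomial whose value at the cardinality of any finite field is the number of
isomorphism classes of representations of dimension `α` over this field. -/
def IsRepCountPoly (Q : Type u) [Quiver.{v} Q] (α : Q →₀ ℕ) (P : ℚ[X]) : Prop :=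
  ∀ (F : Type) [Field F] [Finite F],
    P.eval (Nat.card F : ℚ) = (QuiverRep.numReps Q F α : ℚ)

/-- `a_α(q)` is the polynomial whose value at the cardinality of any finite field is the number of
isomorphism classes of absolutely indecomposable representations of dimension `α` over this
field. -/
def IsAbsIndecCountPoly (Q : Type u) [Quiver.{v} Q] (α : Q →₀ ℕ) (P : ℚ[X]) : Prop :=
  ∀ (F : Type) [Field F] [Finite F],
    P.eval (Nat.card F : ℚ) = (QuiverRep.numAbsIndec Q F α : ℚ)

/-! Fix a prime p and let L be an algebraic closure of F_p. Under direct sum the isomorphism classes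
of representations over L form a commutative monoid, which by Krull–Schmidt is free on the set Y of
indecomposable classes (`IsoClass.bijective_sum`). Frobenius acts on it by an automorphism τ that
preserves dimension vectors. The classes over F_{p^n} are exactly the classes over L fixed by τ^n:
extension of scalars is injective on classes by Noether–Deuring
(`IsoClass.map_algebraMap_injective`), and by Lang's theorem its image is the fixed set
(`IsoClass.mem_range_map_iff`). Hence m_α(F_{p^n}) counts the τ^n-invariant multisets in Y of total
weight α, and a_α(F_{p^n}) counts the τ^n-fixed points of Y of weight α (`count_galoisField`).

What remains is combinatorics of an injective map on a weighted set. At n, the series ψ_k(a) counts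
the fixed points of τ^{nk} with weights multiplied by k, so it is enough to prove Newton's recursion
for the numbers of invariant multisets of given cardinality (`newton_invMultiset`). This is a double
count of pairs: an invariant multiset s with N elements, and a closed walk y, τy, …, τ^{k-1}y with
τ^k y = y contained in s with multiplicity. Removing the walk leaves an invariant multiset with N -
k elements. Conversely s contains exactly N such walks, because a point of minimal period r and
multiplicity c starts those of length r, 2r, …, cr. Therefore σ_N(a) counts invariant multisets of
cardinality N, and Exp(a) counts them all.

For the polynomial form, evaluation at the powers of a single prime is an injective homomorphism
from ℚ[q] to functions that respects Adams operations. The identity thus lifts to ℚ[q] and then maps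
to ℚ(q) (`map_plethExp`). -/

set_option linter.unusedSectionVars false

/-! ### The path algebra and its modules -/

/-- The generators of the path algebra: the vertices and the arrows. -/
inductive PathGen (Q : Type u) [Quiver.{v} Q] : Type (max u v)
  | vertex (i : Q) : PathGen Q
  | arrow (i j : Q) (e : i ⟶ j) : PathGen Q

section PathAlgebra

variable (Q : Type u) [Quiver.{v} Q] [Fintype Q] (K : Type w) [Field K]

/-- The relations of the path algebra. -/
inductive PathRel : FreeAlgebra K (PathGen Q) → FreeAlgebra K (PathGen Q) → Prop
  | vertex_self (i : Q) : PathRel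
      (FreeAlgebra.ι K (.vertex i) * FreeAlgebra.ι K (.vertex i)) (FreeAlgebra.ι K (.vertex i))
  | vertex_ne (i j : Q) (h : i ≠ j) : PathRel
      (FreeAlgebra.ι K (.vertex i) * FreeAlgebra.ι K (.vertex j)) 0
  | vertex_sum : PathRel (∑ i, FreeAlgebra.ι K (.vertex i)) 1
  | target (i j : Q) (e : i ⟶ j) : PathRel
      (FreeAlgebra.ι K (.vertex j) * FreeAlgebra.ι K (.arrow i j e))
      (FreeAlgebra.ι K (.arrow i j e))
  | source (i j : Q) (e : i ⟶ j) : PathRel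
      (FreeAlgebra.ι K (.arrow i j e) * FreeAlgebra.ι K (.vertex i))
      (FreeAlgebra.ι K (.arrow i j e))

/-- The path algebra of a quiver with finitely many vertices. -/
def PathAlgebra : Type (max u v w) := RingQuot (PathRel Q K)

namespace PathAlgebra

instance : Ring (PathAlgebra Q K) := inferInstanceAs (Ring (RingQuot (PathRel Q K)))
instance : Algebra K (PathAlgebra Q K) := inferInstanceAs (Algebra K (RingQuot (PathRel Q K)))

variable {Q}

/-- The quotient map from the free algebra. -/
def mk : FreeAlgebra K (PathGen Q) →ₐ[K] PathAlgebra Q K := RingQuot.mkAlgHom K (PathRel Q K)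

/-- The class of a generator in the path algebra. -/
def of (x : PathGen Q) : PathAlgebra Q K := mk K (FreeAlgebra.ι K x)

theorem mk_rel {a b : FreeAlgebra K (PathGen Q)} (h : PathRel Q K a b) : mk K a = mk K b :=
  RingQuot.mkAlgHom_rel K h

theorem induction {P : PathAlgebra Q K → Prop} (scalar : ∀ r, P (algebraMap K _ r))
    (gen : ∀ x, P (of K x)) (mul : ∀ a b, P a → P b → P (a * b))
    (add : ∀ a b, P a → P b → P (a + b)) (a : PathAlgebra Q K) : P a := by
  obtain ⟨b, rfl⟩ : ∃ b, mk K b = a := RingQuot.mkAlgHom_surjective K (PathRel Q K) a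
  induction b using FreeAlgebra.induction with
  | grade0 r => rw [AlgHom.commutes]; exact scalar r
  | grade1 x => exact gen x
  | mul a b ha hb => rw [map_mul]; exact mul _ _ ha hb
  | add a b ha hb => rw [map_add]; exact add _ _ ha hb

theorem vertex_mul_self (i : Q) : of K (.vertex i) * of K (.vertex i) = of K (.vertex i) :=
  (map_mul _ _ _).symm.trans (mk_rel K (.vertex_self i))

theorem vertex_mul_of_ne {i j : Q} (h : i ≠ j) : of K (.vertex i) * of K (.vertex j) = 0 :=
  (map_mul _ _ _).symm.trans ((mk_rel K (.vertex_ne i j h)).trans (map_zero _))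

theorem sum_vertex : ∑ i : Q, of K (.vertex i) = 1 :=
  (map_sum (mk K) _ _).symm.trans ((mk_rel K .vertex_sum).trans (map_one _))

theorem target_mul {i j : Q} (e : i ⟶ j) :
    of K (.vertex j) * of K (.arrow i j e) = of K (.arrow i j e) :=
  (map_mul _ _ _).symm.trans (mk_rel K (.target i j e))

theorem mul_source {i j : Q} (e : i ⟶ j) :
    of K (.arrow i j e) * of K (.vertex i) = of K (.arrow i j e) :=
  (map_mul _ _ _).symm.trans (mk_rel K (.source i j e))

variable {K}

/-- A `K`-linear map which commutes with the generators is linear over the path algebra. -/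
def mkLinearMap {V W : Type*} [AddCommGroup V] [AddCommGroup W] [Module K V] [Module K W]
    [Module (PathAlgebra Q K) V] [Module (PathAlgebra Q K) W]
    [IsScalarTower K (PathAlgebra Q K) V] [IsScalarTower K (PathAlgebra Q K) W]
    (g : V →ₗ[K] W) (h : ∀ (x : PathGen Q) (v : V), g (of K x • v) = of K x • g v) :
    V →ₗ[PathAlgebra Q K] W where
  toFun := g
  map_add' := map_add g
  map_smul' a v := by
    rw [RingHom.id_apply]
    induction a using PathAlgebra.induction generalizing v with
    | scalar r => rw [algebraMap_smul, algebraMap_smul, map_smul]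
    | gen x => exact h x v
    | mul a b ha hb => rw [mul_smul, mul_smul, ha, hb]
    | add a b ha hb => rw [add_smul, add_smul, map_add, ha, hb]

@[simp] theorem mkLinearMap_apply {V W : Type*} [AddCommGroup V] [AddCommGroup W] [Module K V]
    [Module K W] [Module (PathAlgebra Q K) V] [Module (PathAlgebra Q K) W]
    [IsScalarTower K (PathAlgebra Q K) V] [IsScalarTower K (PathAlgebra Q K) W]
    (g : V →ₗ[K] W) (h : ∀ (x : PathGen Q) (v : V), g (of K x • v) = of K x • g v) (v : V) :
    mkLinearMap g h v = g v := rfl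

end PathAlgebra

end PathAlgebra

open PathAlgebra

/-- The total space of a family of vector spaces and linear maps indexed by a quiver. -/
def TotalSpace {Q : Type u} [Quiver.{v} Q] {K : Type w} [Field K] {V : Q → Type*}
    [∀ i, AddCommGroup (V i)] [∀ i, Module K (V i)]
    (_f : ∀ i j : Q, (i ⟶ j) → V i →ₗ[K] V j) : Type _ := ∀ i, V i

/-! ### The total space of a representation as a module over the path algebra -/

namespace TotalSpace

variable {Q : Type u} [Quiver.{v} Q] [Fintype Q] [DecidableEq Q] {K : Type w} [Field K]
  {V W : Q → Type*}
  [∀ i, AddCommGroup (V i)] [∀ i, Module K (V i)] [∀ i, AddCommGroup (W i)] [∀ i, Module K (W i)]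
  (f : ∀ i j : Q, (i ⟶ j) → V i →ₗ[K] V j) (f' : ∀ i j : Q, (i ⟶ j) → W i →ₗ[K] W j)

@[ext] theorem ext {x y : TotalSpace f} (h : ∀ i, x i = y i) : x = y := funext h

instance : AddCommGroup (TotalSpace f) := inferInstanceAs (AddCommGroup (∀ i, V i))
instance : Module K (TotalSpace f) := inferInstanceAs (Module K (∀ i, V i))
instance [∀ i, Module.Finite K (V i)] : Module.Finite K (TotalSpace f) :=
  inferInstanceAs (Module.Finite K (∀ i, V i))

@[simp] theorem zero_apply (i : Q) : (0 : TotalSpace f) i = 0 := rfl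
@[simp] theorem add_apply (x y : TotalSpace f) (i : Q) : (x + y) i = x i + y i := rfl

/-- The inclusion of the space at a vertex. -/
def single (i : Q) : V i →ₗ[K] TotalSpace f := LinearMap.single K V i

/-- The projection to the space at a vertex. -/
def proj (i : Q) : TotalSpace f →ₗ[K] V i := LinearMap.proj i

@[simp] theorem proj_apply (i : Q) (x : TotalSpace f) : proj f i x = x i := rfl
@[simp] theorem single_same (i : Q) (x : V i) : single f i x i = x := Pi.single_eq_same _ _
theorem single_of_ne {i j : Q} (h : j ≠ i) (x : V i) : single f i x j = 0 :=
  Pi.single_eq_of_ne h _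

/-- The action of the generators of the path algebra. -/
def act : PathGen Q → Module.End K (TotalSpace f)
  | .vertex i => single f i ∘ₗ proj f i
  | .arrow i j e => single f j ∘ₗ f i j e ∘ₗ proj f i

theorem sum_single (x : TotalSpace f) : ∑ i, single f i (x i) = x :=
  Finset.univ_sum_single x

/-- The action of the path algebra. -/
def actHom : PathAlgebra Q K →ₐ[K] Module.End K (TotalSpace f) :=
  RingQuot.liftAlgHom K ⟨FreeAlgebra.lift K (act f), by
    intro a b h
    induction h with
    | vertex_self i => ext x : 1; simp [act]
    | vertex_ne i j h => ext x : 1; simp [act, single_of_ne f h]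
    | vertex_sum => ext x : 1; simp [act, sum_single]
    | target i j e => ext x : 1; simp [act]
    | source i j e => ext x : 1; simp [act]⟩

instance : Module (PathAlgebra Q K) (TotalSpace f) := Module.compHom _ (actHom f).toRingHom

theorem smul_def (a : PathAlgebra Q K) (x : TotalSpace f) : a • x = actHom f a x := rfl

instance : IsScalarTower K (PathAlgebra Q K) (TotalSpace f) where
  smul_assoc c a x := by simp [smul_def]

theorem of_smul (g : PathGen Q) (x : TotalSpace f) : of K g • x = act f g x := by
  rw [smul_def, actHom, of, mk]
  erw [RingQuot.liftAlgHom_mkAlgHom_apply]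
  simp

@[simp] theorem vertex_smul (i : Q) (x : TotalSpace f) :
    of K (.vertex i) • x = single f i (x i) := of_smul f _ x
@[simp] theorem arrow_smul {i j : Q} (e : i ⟶ j) (x : TotalSpace f) :
    of K (.arrow i j e) • x = single f j (f i j e (x i)) := of_smul f _ x

variable {f f'}

/-- The `K`-linear map given by a family of linear maps. -/
def mapPi (f : ∀ i j : Q, (i ⟶ j) → V i →ₗ[K] V j) (f' : ∀ i j : Q, (i ⟶ j) → W i →ₗ[K] W j)
    (g : ∀ i, V i →ₗ[K] W i) : TotalSpace f →ₗ[K] TotalSpace f' where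
  toFun x i := g i (x i)
  map_add' x y := by ext i; exact map_add (g i) (x i) (y i)
  map_smul' c x := by ext i; exact map_smul (g i) c (x i)

@[simp] theorem mapPi_apply (g : ∀ i, V i →ₗ[K] W i) (x : TotalSpace f) (i : Q) :
    mapPi f f' g x i = g i (x i) := rfl

theorem mapPi_single (g : ∀ i, V i →ₗ[K] W i) (i : Q) (y : V i) :
    mapPi f f' g (single f i y) = single f' i (g i y) := by
  ext k
  rcases eq_or_ne k i with rfl | hk
  · simp
  · simp [single_of_ne _ hk]

/-- A family of linear maps which commutes with the arrows. -/
def mapLinear (g : ∀ i, V i →ₗ[K] W i)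
    (h : ∀ (i j : Q) (e : i ⟶ j) (x : V i), g j (f i j e x) = f' i j e (g i x)) :
    TotalSpace f →ₗ[PathAlgebra Q K] TotalSpace f' :=
  mkLinearMap (mapPi f f' g) <| by
    rintro (i | ⟨i, j, e⟩) x
    · simp [mapPi_single]
    · simp [mapPi_single, h]

@[simp] theorem mapLinear_apply (g : ∀ i, V i →ₗ[K] W i)
    (h : ∀ (i j : Q) (e : i ⟶ j) (x : V i), g j (f i j e x) = f' i j e (g i x))
    (x : TotalSpace f) (i : Q) : mapLinear g h x i = g i (x i) := rfl

/-- A family of linear equivalences which commutes with the arrows. -/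
def mapEquiv (g : ∀ i, V i ≃ₗ[K] W i)
    (h : ∀ (i j : Q) (e : i ⟶ j) (x : V i), g j (f i j e x) = f' i j e (g i x)) :
    TotalSpace f ≃ₗ[PathAlgebra Q K] TotalSpace f' :=
  LinearEquiv.ofLinearMap (mapLinear (fun i => (g i).toLinearMap) h)
    (mapLinear (fun i => (g i).symm.toLinearMap) (f := f') (f' := f) fun i j e x => by
      apply (g j).injective
      simp [h])
    (by ext x i; simp) (by ext x i; simp)

/-- The image is fixed by the idempotent of the vertex `i`, hence concentrated at that vertex. -/
theorem linearMap_single (φ : TotalSpace f →ₗ[PathAlgebra Q K] TotalSpace f') (i : Q) (x : V i) :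
    φ (single f i x) = single f' i (φ (single f i x) i) := by
  conv_lhs => rw [← single_same f i x, ← vertex_smul, map_smul, vertex_smul]

/-- The components of a linear map over the path algebra. -/
def component (φ : TotalSpace f →ₗ[PathAlgebra Q K] TotalSpace f') (i : Q) : V i →ₗ[K] W i :=
  proj f' i ∘ₗ φ.restrictScalars K ∘ₗ single f i

theorem component_apply (φ : TotalSpace f →ₗ[PathAlgebra Q K] TotalSpace f') (i : Q) (x : V i) :
    component φ i x = φ (single f i x) i := rfl

theorem component_arrow (φ : TotalSpace f →ₗ[PathAlgebra Q K] TotalSpace f') {i j : Q} (e : i ⟶ j)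
    (x : V i) : component φ j (f i j e x) = f' i j e (component φ i x) := by
  rw [component_apply, component_apply]
  have := arrow_smul f e (single f i x)
  rw [single_same] at this
  rw [← this, map_smul, arrow_smul, single_same]

/-- The components of a linear equivalence over the path algebra. -/
def componentEquiv (φ : TotalSpace f ≃ₗ[PathAlgebra Q K] TotalSpace f') (i : Q) :
    V i ≃ₗ[K] W i :=
  LinearEquiv.ofLinearMap (component φ.toLinearMap i) (component φ.symm.toLinearMap i)
    (by
      ext x
      simp only [LinearMap.comp_apply, component_apply, LinearMap.id_apply]
      rw [← linearMap_single]; simp)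
    (by
      ext x
      simp only [LinearMap.comp_apply, component_apply, LinearMap.id_apply]
      rw [← linearMap_single]; simp)

theorem componentEquiv_arrow (φ : TotalSpace f ≃ₗ[PathAlgebra Q K] TotalSpace f') {i j : Q}
    (e : i ⟶ j) (x : V i) :
    componentEquiv φ j (f i j e x) = f' i j e (componentEquiv φ i x) :=
  component_arrow φ.toLinearMap e x

end TotalSpace

/-! ### Splitting a module along the vertex idempotents -/

section Vertex

variable {Q : Type u} [Quiver.{v} Q] [Fintype Q] [DecidableEq Q] {K : Type w} [Field K]
  (V : Type*) [AddCommGroup V] [Module K V] [Module (PathAlgebra Q K) V]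
  [IsScalarTower K (PathAlgebra Q K) V]

/-- Multiplication by an element of the path algebra, as a `K`-linear map. -/
def smulLinear (a : PathAlgebra Q K) : V →ₗ[K] V where
  toFun x := a • x
  map_add' := smul_add a
  map_smul' c x := by
    rw [RingHom.id_apply, ← algebraMap_smul (PathAlgebra Q K) c x,
      ← algebraMap_smul (PathAlgebra Q K) c (a • x), ← mul_smul, ← mul_smul, Algebra.commutes]

variable (K) in
/-- The vector space at a vertex attached to a module over the path algebra. -/
def vertexSpace (i : Q) : Submodule K V := LinearMap.range (smulLinear V (of K (.vertex i)))

variable {V}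

theorem vertex_smul_mem (i : Q) (x : V) : of K (.vertex i) • x ∈ vertexSpace K V i := ⟨x, rfl⟩

theorem vertex_smul_of_mem {i : Q} {x : V} (hx : x ∈ vertexSpace K V i) :
    of K (.vertex i) • x = x := by
  obtain ⟨y, rfl⟩ := hx
  change of K (.vertex i) • of K (.vertex i) • y = of K (.vertex i) • y
  rw [← mul_smul, vertex_mul_self]

theorem vertex_smul_of_mem_of_ne {i j : Q} (h : j ≠ i) {x : V} (hx : x ∈ vertexSpace K V i) :
    of K (.vertex j) • x = 0 := by
  rw [← vertex_smul_of_mem hx, ← mul_smul, vertex_mul_of_ne K h, zero_smul]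

theorem sum_vertex_smul (x : V) : ∑ i : Q, of K (.vertex i) • x = x := by
  rw [← Finset.sum_smul, sum_vertex, one_smul]

variable (V)

/-- The action of an arrow between the spaces at its ends. -/
def arrowMap (i j : Q) (e : i ⟶ j) : vertexSpace K V i →ₗ[K] vertexSpace K V j :=
  ((smulLinear V (of K (.arrow i j e))).domRestrict _).codRestrict _ fun x => by
    change of K (.arrow i j e) • (x : V) ∈ _
    rw [← target_mul, mul_smul]
    exact vertex_smul_mem _ _

@[simp] theorem coe_arrowMap {i j : Q} (e : i ⟶ j) (x : vertexSpace K V i) :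
    (arrowMap V i j e x : V) = of K (.arrow i j e) • (x : V) := rfl

/-- The decomposition of a module over the path algebra into the spaces at the vertices, as a map
of vector spaces. -/
def vertexProj : V →ₗ[K] TotalSpace (arrowMap (Q := Q) (K := K) V) where
  toFun x i := ⟨of K (.vertex i) • x, vertex_smul_mem i x⟩
  map_add' x y := by ext i; exact smul_add _ _ _
  map_smul' c x := by ext i; exact map_smul (smulLinear V (of K (.vertex i))) c x

@[simp] theorem coe_vertexProj (x : V) (i : Q) :
    (vertexProj (Q := Q) (K := K) V x i : V) = of K (.vertex i) • x := rfl

theorem vertexProj_of_mem {i : Q} {x : V} (hx : x ∈ vertexSpace K V i) :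
    vertexProj V x = TotalSpace.single (arrowMap V) i ⟨x, hx⟩ := by
  ext k
  rcases eq_or_ne k i with rfl | hk
  · simp [vertex_smul_of_mem hx]
  · simp [TotalSpace.single_of_ne _ hk, vertex_smul_of_mem_of_ne hk hx]

/-- A module over the path algebra is the total space of a family of vector spaces. -/
noncomputable def vertexEquiv :
    V ≃ₗ[PathAlgebra Q K] TotalSpace (arrowMap (Q := Q) (K := K) V) :=
  LinearEquiv.ofBijective
    (mkLinearMap (vertexProj (Q := Q) (K := K) V) <| by
      rintro (i | ⟨i, j, e⟩) x
      · rw [vertexProj_of_mem V (vertex_smul_mem i x), TotalSpace.vertex_smul]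
        rfl
      · have : of K (.arrow i j e) • x ∈ vertexSpace K V j := by
          rw [← target_mul, mul_smul]; exact vertex_smul_mem _ _
        rw [vertexProj_of_mem V this, TotalSpace.arrow_smul]
        congr 1
        ext
        simp only [coe_arrowMap, coe_vertexProj, ← mul_smul, mul_source]) <| by
    constructor
    · refine (injective_iff_map_eq_zero _).2 fun x hx => ?_
      rw [← sum_vertex_smul (Q := Q) (K := K) x]
      refine Finset.sum_eq_zero fun i _ => ?_
      exact congrArg (fun y : TotalSpace (arrowMap (Q := Q) (K := K) V) => (y i : V)) hx
    · intro y
      refine ⟨∑ i, (y i : V), ?_⟩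
      rw [mkLinearMap_apply, map_sum]
      conv_rhs => rw [← TotalSpace.sum_single _ y]
      exact Finset.sum_congr rfl fun i _ => vertexProj_of_mem V (y i).2

end Vertex

/-! ### Translation between representations and modules -/

namespace QuiverRep

variable {Q : Type u} [Quiver.{v} Q] [Fintype Q] [DecidableEq Q] {K : Type w} [Field K]
  {α β : Q → ℕ}

/-- The module over the path algebra attached to a representation. -/
abbrev Space (M : QuiverRep Q K α) : Type _ :=
  TotalSpace (V := fun i => Fin (α i) → K) fun i j e => (M i j e).mulVecLin

/-- Every finite-dimensional module over the path algebra comes from a representation. -/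
theorem exists_space_equiv (V : Type*) [AddCommGroup V] [Module K V] [Module (PathAlgebra Q K) V]
    [IsScalarTower K (PathAlgebra Q K) V] [Module.Finite K V] :
    ∃ (α : Q → ℕ) (M : QuiverRep Q K α), Nonempty (V ≃ₗ[PathAlgebra Q K] M.Space) := by
  let b (i : Q) := (Module.finBasis K (vertexSpace K V i)).equivFun
  let M : QuiverRep Q K fun i => Module.finrank K (vertexSpace K V i) := fun i j e =>
    LinearMap.toMatrix' ((b j).toLinearMap ∘ₗ arrowMap V i j e ∘ₗ (b i).symm.toLinearMap)
  refine ⟨_, M, ⟨(vertexEquiv V).trans (TotalSpace.mapEquiv b fun i j e x => ?_)⟩⟩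
  simp [M]

/-- A map linear over the path algebra commutes with the vertex idempotents, so it is a family of
linear maps at the vertices; linearity for the arrows is then the intertwining relation. -/
theorem nonempty_equiv_iff {M N : QuiverRep Q K α} :
    Nonempty (M.Space ≃ₗ[PathAlgebra Q K] N.Space) ↔ Iso M N := by
  constructor
  · rintro ⟨φ⟩
    let c := TotalSpace.componentEquiv φ
    refine ⟨fun i => ⟨LinearMap.toMatrix' (c i).toLinearMap,
      LinearMap.toMatrix' (c i).symm.toLinearMap, ?_, ?_⟩, fun i j e => ?_⟩
    · rw [← LinearMap.toMatrix'_comp]; simp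
    · rw [← LinearMap.toMatrix'_comp]; simp
    · apply Matrix.toLin'.injective
      ext1 x
      ext1
      simpa [c] using TotalSpace.componentEquiv_arrow φ e (Pi.single x 1)
  · rintro ⟨g, hg⟩
    refine ⟨TotalSpace.mapEquiv (fun i => LinearMap.GeneralLinearGroup.toLinearEquiv
      (Matrix.GeneralLinearGroup.toLin (g i))) fun i j e x => ?_⟩
    have := congrArg (fun A => A.mulVec x) (hg i j e)
    simpa [Matrix.GeneralLinearGroup.toLin_apply] using this

theorem dim_eq_of_equiv {M : QuiverRep Q K α} {N : QuiverRep Q K β}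
    (φ : M.Space ≃ₗ[PathAlgebra Q K] N.Space) : α = β := by
  ext i
  simpa using (TotalSpace.componentEquiv φ i).finrank_eq

/-- The submodule of the total space given by a subrepresentation. -/
def IsSubrep.toSubmodule {M : QuiverRep Q K α} {U : ∀ i, Submodule K (Fin (α i) → K)}
    (hU : M.IsSubrep U) : Submodule (PathAlgebra Q K) M.Space where
  carrier := {x | ∀ i, x i ∈ U i}
  zero_mem' i := (U i).zero_mem
  add_mem' hx hy i := (U i).add_mem (hx i) (hy i)
  smul_mem' a x hx := by
    induction a using PathAlgebra.induction generalizing x with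
    | scalar r =>
      rw [algebraMap_smul]
      exact fun i => (U i).smul_mem r (hx i)
    | gen g =>
      rcases g with i | ⟨i, j, e⟩
      · intro k
        rw [TotalSpace.vertex_smul]
        rcases eq_or_ne k i with rfl | hk
        · simpa using hx k
        · simp [TotalSpace.single_of_ne _ hk]
      · intro k
        rw [TotalSpace.arrow_smul]
        rcases eq_or_ne k j with rfl | hk
        · simpa using hU i k e _ (hx i)
        · simp [TotalSpace.single_of_ne _ hk]
    | mul a b ha hb => rw [mul_smul]; exact ha _ (hb _ hx)
    | add a b ha hb => rw [add_smul]; exact fun i => (U i).add_mem (ha _ hx i) (hb _ hx i)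

/-- The family of subspaces given by a submodule of the total space. -/
def componentSubmodule {M : QuiverRep Q K α} (P : Submodule (PathAlgebra Q K) M.Space) (i : Q) :
    Submodule K (Fin (α i) → K) where
  carrier := {x | TotalSpace.single _ i x ∈ P}
  zero_mem' := by simp
  add_mem' hx hy := by simpa using P.add_mem hx hy
  smul_mem' c x hx := by
    simpa [algebraMap_smul] using P.smul_mem (algebraMap K _ c) hx

theorem mem_componentSubmodule {M : QuiverRep Q K α} {P : Submodule (PathAlgebra Q K) M.Space}
    {i : Q} {x : Fin (α i) → K} :
    x ∈ componentSubmodule P i ↔ TotalSpace.single _ i x ∈ P := Iff.rfl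

/-- Submodules are stable under the vertex idempotents, so they are recovered from their components.
This allows complements to be tested vertex by vertex. -/
theorem apply_mem_componentSubmodule {M : QuiverRep Q K α}
    {P : Submodule (PathAlgebra Q K) M.Space} {x : M.Space} (hx : x ∈ P) (i : Q) :
    x i ∈ componentSubmodule P i := by
  rw [mem_componentSubmodule, ← TotalSpace.vertex_smul]
  exact P.smul_mem _ hx

theorem eq_bot_of_componentSubmodule {M : QuiverRep Q K α}
    {P : Submodule (PathAlgebra Q K) M.Space} (h : ∀ i, componentSubmodule P i = ⊥) : P = ⊥ := by
  rw [eq_bot_iff]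
  intro x hx
  rw [Submodule.mem_bot]
  ext1 i
  have := apply_mem_componentSubmodule hx i
  rwa [h, Submodule.mem_bot] at this

theorem isSubrep_componentSubmodule {M : QuiverRep Q K α}
    (P : Submodule (PathAlgebra Q K) M.Space) : M.IsSubrep (componentSubmodule P) := by
  intro i j e x hx
  have := P.smul_mem (of K (.arrow i j e)) hx
  rwa [TotalSpace.arrow_smul, TotalSpace.single_same] at this

theorem isCompl_componentSubmodule {M : QuiverRep Q K α}
    {P P' : Submodule (PathAlgebra Q K) M.Space} (h : IsCompl P P') (i : Q) :
    IsCompl (componentSubmodule P i) (componentSubmodule P' i) := by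
  constructor
  · rw [Submodule.disjoint_def]
    intro x hx hx'
    have := Submodule.disjoint_def.1 h.disjoint _ hx hx'
    rw [← TotalSpace.single_same (fun i j e => (M i j e).mulVecLin) i x, this]
    rfl
  · rw [codisjoint_iff, eq_top_iff]
    intro x _
    obtain ⟨y, hy, z, hz, hyz⟩ := Submodule.mem_sup.1
      ((codisjoint_iff.1 h.codisjoint).symm ▸ Submodule.mem_top :
        TotalSpace.single (fun i j e => (M i j e).mulVecLin) i x ∈ P ⊔ P')
    refine Submodule.mem_sup.2 ⟨y i, apply_mem_componentSubmodule hy i, z i,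
      apply_mem_componentSubmodule hz i, ?_⟩
    rw [← TotalSpace.add_apply, hyz, TotalSpace.single_same]

theorem IsSubrep.isCompl_toSubmodule {M : QuiverRep Q K α}
    {U W : ∀ i, Submodule K (Fin (α i) → K)} (hU : M.IsSubrep U) (hW : M.IsSubrep W)
    (h : ∀ i, IsCompl (U i) (W i)) : IsCompl hU.toSubmodule hW.toSubmodule := by
  constructor
  · rw [Submodule.disjoint_def]
    intro x hx hx'
    ext1 i
    exact Submodule.disjoint_def.1 (h i).disjoint _ (hx i) (hx' i)
  · rw [codisjoint_iff, eq_top_iff]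
    intro x _
    have key : ∀ i, ∃ y ∈ U i, ∃ z ∈ W i, y + z = x i := fun i =>
      Submodule.mem_sup.1 ((codisjoint_iff.1 (h i).codisjoint).symm ▸ Submodule.mem_top)
    choose y hy z hz hyz using key
    exact Submodule.mem_sup.2 ⟨y, hy, z, hz, funext hyz⟩

theorem isIndecomposable_iff {M : QuiverRep Q K α} : M.IsIndecomposable ↔
    Nontrivial M.Space ∧ ∀ P P' : Submodule (PathAlgebra Q K) M.Space,
      IsCompl P P' → P = ⊥ ∨ P' = ⊥ := by
  refine and_congr ?_ ⟨fun h P P' hP => ?_, fun h U W hU hW hUW => ?_⟩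
  · constructor
    · rintro ⟨i, hi⟩
      have : NeZero (α i) := ⟨hi⟩
      refine ⟨⟨TotalSpace.single _ i 1, 0, fun h => ?_⟩⟩
      have := congrArg (fun x : M.Space => x i 0) h
      simp at this
    · intro h
      by_contra! hα
      obtain ⟨x, hx⟩ := exists_ne (0 : M.Space)
      apply hx
      ext i k
      exact absurd k.2 (by simp [hα])
  · exact (h _ _ (isSubrep_componentSubmodule P) (isSubrep_componentSubmodule P')
      (isCompl_componentSubmodule hP)).imp eq_bot_of_componentSubmodule
      eq_bot_of_componentSubmodule
  · have aux : ∀ {U : ∀ i, Submodule K (Fin (α i) → K)} (hU : M.IsSubrep U),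
        hU.toSubmodule = ⊥ → ∀ i, U i = ⊥ := by
      intro U hU hbot i
      rw [eq_bot_iff]
      intro x hx
      have hmem : TotalSpace.single (fun i j e => (M i j e).mulVecLin) i x ∈ hU.toSubmodule := by
        intro k
        rcases eq_or_ne k i with rfl | hk
        · simpa using hx
        · simp [TotalSpace.single_of_ne _ hk]
      rw [hbot, Submodule.mem_bot] at hmem
      rw [Submodule.mem_bot, ← TotalSpace.single_same (fun i j e => (M i j e).mulVecLin) i x, hmem]
      rfl
    exact (h _ _ (hU.isCompl_toSubmodule hW hUW)).imp (aux hU) (aux hW)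

end QuiverRep

/-! ### Exchange property of modules with local endomorphism ring -/

section Exchange

variable {R : Type*} [Ring R] {Y M N P Z : Type*} [AddCommGroup Y] [Module R Y]
  [AddCommGroup M] [Module R M] [AddCommGroup N] [Module R N] [AddCommGroup P] [Module R P]
  [AddCommGroup Z] [Module R Z]

/-- In the endomorphism ring of an indecomposable module of finite length, one of two elements
with sum `1` is invertible. -/
theorem bijective_or_bijective_of_add_eq_id [IsArtinian R Y] [IsNoetherian R Y]
    (hY : ∀ U U' : Submodule R Y, IsCompl U U' → U = ⊥ ∨ U' = ⊥) {a b : Module.End R Y}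
    (hab : a + b = 1) : Function.Bijective a ∨ Function.Bijective b := by
  -- Fitting's lemma: kernel and range of a high power of `a` are complementary, so `a` is injective
  -- or nilpotent. The exponent `n + 1` is positive so that a factor `a` can be split off.
  obtain ⟨n, hn⟩ := Filter.eventually_atTop.1 a.eventually_isCompl_ker_pow_range_pow
  have hn := hn (n + 1) (Nat.le_succ n)
  rcases hY _ _ hn with h | h
  · left
    apply IsArtinian.bijective_of_injective_endomorphism
    have := LinearMap.ker_eq_bot.1 h
    rw [pow_succ] at this
    exact Function.Injective.of_comp this
  · right
    have h0 : a ^ (n + 1) = 0 := LinearMap.range_eq_bot.1 h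
    have hb : b = 1 - a := by rw [← hab]; abel
    rw [hb]
    exact (Module.End.isUnit_iff _).1 (IsNilpotent.isUnit_one_sub ⟨_, h0⟩)

/-- A retract is a direct summand. -/
theorem nonempty_prod_ker_equiv {f : Y →ₗ[R] N} {g : N →ₗ[R] Y}
    (h : Function.Bijective (g ∘ₗ f)) : Nonempty (N ≃ₗ[R] Y × LinearMap.ker g) := by
  refine ⟨(LinearEquiv.ofBijective (f.coprod (LinearMap.ker g).subtype) ⟨?_, fun x => ?_⟩).symm⟩
  · refine (injective_iff_map_eq_zero _).2 ?_
    rintro ⟨y, n, hn⟩ hyn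
    have h1 : f y + n = 0 := by simpa using hyn
    have h2 : (g ∘ₗ f) y = (g ∘ₗ f) 0 := by
      have := congrArg g h1
      rw [map_add, LinearMap.mem_ker.1 hn, add_zero, map_zero] at this
      simpa using this
    obtain rfl := h.1 h2
    simpa using h1
  · obtain ⟨y, hy⟩ := h.2 (g x)
    refine ⟨(y, ⟨x - f y, ?_⟩), by simp⟩
    rw [LinearMap.mem_ker, map_sub, sub_eq_zero, ← hy]
    rfl

/-- Two complements of a summand are isomorphic. -/
theorem nonempty_equiv_ker (φ : (Y × M) ≃ₗ[R] Z) {g : Z →ₗ[R] Y}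
    (h : Function.Bijective (g ∘ₗ φ.toLinearMap ∘ₗ LinearMap.inl R Y M)) :
    Nonempty (M ≃ₗ[R] LinearMap.ker g) := by
  let u := LinearEquiv.ofBijective _ h
  have hu : ∀ y, u y = g (φ (y, 0)) := fun y => rfl
  -- The value `c m` is the element of `Y` with the same image under `g` as `m`; subtracting it
  -- moves the given complement `M` into the kernel of `g`.
  let c : M →ₗ[R] Y := u.symm.toLinearMap ∘ₗ g ∘ₗ φ.toLinearMap ∘ₗ LinearMap.inr R Y M
  have hc : ∀ m, g (φ (c m, 0)) = g (φ (0, m)) := fun m => by rw [← hu]; simp [c]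
  let ψ : M →ₗ[R] Z := φ.toLinearMap ∘ₗ ((-c).prod LinearMap.id)
  have hψ : ∀ m, ψ m = φ (0, m) - φ (c m, 0) := fun m => by
    rw [← map_sub]; simp [ψ]
  refine ⟨LinearEquiv.ofBijective (ψ.codRestrict (LinearMap.ker g) fun m => ?_)
    ⟨fun m m' hm => ?_, ?_⟩⟩
  · rw [LinearMap.mem_ker, hψ, map_sub, hc, sub_self]
  · have : ψ m = ψ m' := congrArg Subtype.val hm
    exact (Prod.ext_iff.1 (φ.injective this)).2
  · rintro ⟨z, hz⟩
    obtain ⟨⟨y, m⟩, rfl⟩ := φ.surjective z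
    refine ⟨m, Subtype.ext (congrArg φ (Prod.ext ?_ rfl))⟩
    apply u.injective
    have h1 : g (φ (y, 0)) + g (φ (0, m)) = 0 := by
      rw [← map_add, ← map_add]; simpa using hz
    change u (-c m) = u y
    rw [map_neg, hu, hu, hc, neg_eq_iff_add_eq_zero, add_comm, h1]

/-- The kernel of a map which factors through a projection. -/
def kerCompFstEquiv (g : N →ₗ[R] Y) :
    LinearMap.ker (g ∘ₗ LinearMap.fst R N P) ≃ₗ[R] LinearMap.ker g × P where
  toFun x := (⟨x.1.1, x.2⟩, x.1.2)
  invFun x := ⟨(x.1.1, x.2), x.1.2⟩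
  map_add' _ _ := rfl
  map_smul' _ _ := rfl
  left_inv _ := rfl
  right_inv _ := rfl

/-- Both `M` and the kernel of `N × P → N → Y` are complements of `Y`, and that kernel is `ker g ×
P`. -/
theorem exchange_of_bijective (φ : (Y × M) ≃ₗ[R] (N × P)) (g : N →ₗ[R] Y)
    (h : Function.Bijective
      (g ∘ₗ LinearMap.fst R N P ∘ₗ φ.toLinearMap ∘ₗ LinearMap.inl R Y M)) :
    ∃ N' : Submodule R N, Nonempty (N ≃ₗ[R] Y × N') ∧ Nonempty (M ≃ₗ[R] N' × P) := by
  refine ⟨LinearMap.ker g, nonempty_prod_ker_equiv h, ?_⟩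
  obtain ⟨e⟩ := nonempty_equiv_ker φ (g := g ∘ₗ LinearMap.fst R N P) h
  exact ⟨e.trans (kerCompFstEquiv g)⟩

/-- The exchange property of an indecomposable module of finite length. -/
theorem exchange [IsArtinian R Y] [IsNoetherian R Y]
    (hY : ∀ U U' : Submodule R Y, IsCompl U U' → U = ⊥ ∨ U' = ⊥)
    (φ : (Y × M) ≃ₗ[R] (N × P)) :
    (∃ N' : Submodule R N, Nonempty (N ≃ₗ[R] Y × N') ∧ Nonempty (M ≃ₗ[R] N' × P)) ∨
    (∃ P' : Submodule R P, Nonempty (P ≃ₗ[R] Y × P') ∧ Nonempty (M ≃ₗ[R] P' × N)) := by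
  let p : N × P →ₗ[R] Y := LinearMap.fst R Y M ∘ₗ φ.symm.toLinearMap
  let ψ : (Y × M) ≃ₗ[R] (P × N) := φ.trans (LinearEquiv.prodComm R N P)
  -- The identity of `Y` is the sum of the paths `Y → N → Y` and `Y → P → Y`; one of the two is
  -- bijective and splits `Y` off the corresponding factor.
  have hab : ((p ∘ₗ LinearMap.inl R N P) ∘ₗ LinearMap.fst R N P ∘ₗ φ.toLinearMap ∘ₗ
        LinearMap.inl R Y M) +
      ((p ∘ₗ LinearMap.inr R N P) ∘ₗ LinearMap.fst R P N ∘ₗ ψ.toLinearMap ∘ₗ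
        LinearMap.inl R Y M) = (1 : Module.End R Y) := by
    ext y
    simp only [LinearMap.add_apply, LinearMap.comp_apply, ← map_add]
    simp [p, ψ]
  exact (bijective_or_bijective_of_add_eq_id hY hab).imp (exchange_of_bijective φ _)
    (exchange_of_bijective ψ _)

end Exchange

/-! ### Unique decomposition in commutative monoids -/

section Monoid

variable {S : Type*} [AddCommMonoid S]

/-- A nonzero element which is not a sum of two nonzero elements. -/
def IsIndec (y : S) : Prop := y ≠ 0 ∧ ∀ a b, y = a + b → a = 0 ∨ b = 0

variable (dim : S →+ ℕ) (hdim : ∀ x, dim x = 0 → x = 0)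

include hdim in
-- Descent on `dim`: in a proper decomposition both summands have positive, hence strictly smaller,
-- dimension.
theorem exists_sum_isIndec (x : S) : ∃ s : Multiset {y : S // IsIndec y},
    (s.map Subtype.val).sum = x := by
  induction h : dim x using Nat.strong_induction_on generalizing x with
  | _ n ih =>
    subst h
    by_cases hx : x = 0
    · exact ⟨0, by simp [hx]⟩
    by_cases hi : IsIndec x
    · exact ⟨{⟨x, hi⟩}, by simp⟩
    · have : ∃ a b, x = a + b ∧ a ≠ 0 ∧ b ≠ 0 := by
        by_contra! hcon
        exact hi ⟨hx, fun a b hab => or_iff_not_imp_left.2 (hcon a b hab)⟩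
      obtain ⟨a, b, rfl, ha, hb⟩ := this
      have ha' : dim a ≠ 0 := fun h => ha (hdim a h)
      have hb' : dim b ≠ 0 := fun h => hb (hdim b h)
      obtain ⟨s, rfl⟩ := ih (dim a) (by rw [map_add]; omega) a rfl
      obtain ⟨t, rfl⟩ := ih (dim b) (by rw [map_add]; omega) b rfl
      exact ⟨s + t, by simp⟩

variable (hex : ∀ y m n p : S, IsIndec y → y + m = n + p →
  (∃ n', n = y + n' ∧ m = n' + p) ∨ (∃ p', p = y + p' ∧ m = p' + n))

include hdim hex in
-- Exchange `y` against the first term of `t` and the sum of the rest. If `y` splits off the first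
-- term, indecomposability makes them equal; otherwise `y` splits off the rest and induction
-- applies.
theorem exists_cons_of_add_eq_sum (y : {y : S // IsIndec y}) (m : S)
    (t : Multiset {y : S // IsIndec y}) (h : y.1 + m = (t.map Subtype.val).sum) :
    ∃ t', t = y ::ₘ t' ∧ m = (t'.map Subtype.val).sum := by
  induction t using Multiset.induction_on generalizing m with
  | empty =>
    have := congrArg dim h
    simp only [map_add, Multiset.map_zero, Multiset.sum_zero, map_zero] at this
    exact absurd (hdim y.1 (by omega)) y.2.1
  | cons n t ih =>
    rw [Multiset.map_cons, Multiset.sum_cons] at h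
    rcases hex _ _ _ _ y.2 h with ⟨n', hn, hm⟩ | ⟨p', hp, hm⟩
    · rcases n.2.2 _ _ hn with h0 | h0
      · exact absurd h0 y.2.1
      · subst h0
        rw [add_zero] at hn
        rw [zero_add] at hm
        exact ⟨t, by rw [Subtype.ext hn], hm⟩
    · obtain ⟨t', rfl, rfl⟩ := ih p' hp.symm
      exact ⟨n ::ₘ t', Multiset.cons_swap _ _ _, by rw [hm]; simp [add_comm]⟩

include hdim hex in
/-- The exchange property implies unique decomposition. -/
theorem bijective_sum_isIndec :
    Function.Bijective fun s : Multiset {y : S // IsIndec y} => (s.map Subtype.val).sum := by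
  refine ⟨fun s t => ?_, exists_sum_isIndec dim hdim⟩
  change (s.map Subtype.val).sum = (t.map Subtype.val).sum → s = t
  induction s using Multiset.induction_on generalizing t with
  | empty =>
    intro h
    rcases Multiset.empty_or_exists_mem t with rfl | ⟨y, hy⟩
    · rfl
    · obtain ⟨t', rfl⟩ := Multiset.exists_cons_of_mem hy
      have := congrArg dim h
      simp only [Multiset.map_cons, Multiset.sum_cons, map_add, Multiset.map_zero,
        Multiset.sum_zero, map_zero] at this
      exact absurd (hdim y.1 (by omega)) y.2.1
  | cons y s ih =>
    intro h
    rw [Multiset.map_cons, Multiset.sum_cons] at h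
    obtain ⟨t', rfl, h'⟩ := exists_cons_of_add_eq_sum dim hdim hex y _ t h
    rw [ih t' h']

end Monoid

/-! ### The monoid of isomorphism classes -/

namespace QuiverRep

variable (Q : Type u) [Quiver.{v} Q] [Fintype Q] [DecidableEq Q] (K : Type w) [Field K]

/-- Isomorphism of representations of arbitrary dimension. -/
def sigmaSetoid : Setoid (Σ α : Q → ℕ, QuiverRep Q K α) where
  r X Y := Nonempty (X.2.Space ≃ₗ[PathAlgebra Q K] Y.2.Space)
  iseqv := ⟨fun _ => ⟨LinearEquiv.refl _ _⟩, fun ⟨e⟩ => ⟨e.symm⟩, fun ⟨e⟩ ⟨e'⟩ => ⟨e.trans e'⟩⟩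

/-- The isomorphism classes of representations of arbitrary dimension. -/
def IsoClass : Type (max u v w) := Quotient (sigmaSetoid Q K)

variable {Q K} {α β : Q → ℕ}

namespace IsoClass

/-- The isomorphism class of a representation. -/
def mk (M : QuiverRep Q K α) : IsoClass Q K := Quotient.mk (sigmaSetoid Q K) ⟨α, M⟩

theorem mk_eq_mk_iff_nonempty_equiv {M : QuiverRep Q K α} {N : QuiverRep Q K β} :
    mk M = mk N ↔ Nonempty (M.Space ≃ₗ[PathAlgebra Q K] N.Space) := Quotient.eq

theorem mk_eq_mk_iff {M N : QuiverRep Q K α} : mk M = mk N ↔ Iso M N :=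
  mk_eq_mk_iff_nonempty_equiv.trans nonempty_equiv_iff

theorem exists_mk (x : IsoClass Q K) : ∃ (α : Q → ℕ) (M : QuiverRep Q K α), mk M = x := by
  obtain ⟨⟨α, M⟩, rfl⟩ := Quotient.exists_rep x
  exact ⟨α, M, rfl⟩

/-- The isomorphism class of a finite-dimensional module over the path algebra. -/
noncomputable def of (V : Type*) [AddCommGroup V] [Module K V] [Module (PathAlgebra Q K) V]
    [IsScalarTower K (PathAlgebra Q K) V] [Module.Finite K V] : IsoClass Q K :=
  mk (exists_space_equiv (Q := Q) (K := K) V).choose_spec.choose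

section Of

variable {V W : Type*} [AddCommGroup V] [Module K V] [Module (PathAlgebra Q K) V]
    [IsScalarTower K (PathAlgebra Q K) V] [Module.Finite K V]
  [AddCommGroup W] [Module K W] [Module (PathAlgebra Q K) W]
    [IsScalarTower K (PathAlgebra Q K) W] [Module.Finite K W]

theorem of_eq_of_iff : (of V : IsoClass Q K) = of W ↔ Nonempty (V ≃ₗ[PathAlgebra Q K] W) := by
  obtain ⟨e⟩ := (exists_space_equiv (Q := Q) (K := K) V).choose_spec.choose_spec
  obtain ⟨e'⟩ := (exists_space_equiv (Q := Q) (K := K) W).choose_spec.choose_spec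
  rw [of, of, mk_eq_mk_iff_nonempty_equiv]
  exact ⟨fun ⟨i⟩ => ⟨(e.trans i).trans e'.symm⟩, fun ⟨i⟩ => ⟨(e.symm.trans i).trans e'⟩⟩

theorem of_congr (e : V ≃ₗ[PathAlgebra Q K] W) : (of V : IsoClass Q K) = of W :=
  of_eq_of_iff.2 ⟨e⟩

end Of

theorem of_space (M : QuiverRep Q K α) : of M.Space = mk M := by
  obtain ⟨e⟩ := (exists_space_equiv (Q := Q) (K := K) M.Space).choose_spec.choose_spec
  exact mk_eq_mk_iff_nonempty_equiv.2 ⟨e.symm⟩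

noncomputable instance : Add (IsoClass Q K) where
  add := Quotient.map₂ (fun X Y => ⟨_, (exists_space_equiv (Q := Q) (K := K)
    (X.2.Space × Y.2.Space)).choose_spec.choose⟩) <| by
    rintro X X' ⟨e⟩ Y Y' ⟨e'⟩
    exact Quotient.eq.1 (of_congr (e.prodCongr e'))

theorem mk_add_mk (M : QuiverRep Q K α) (N : QuiverRep Q K β) :
    mk M + mk N = of (M.Space × N.Space) := rfl

section Of

variable {V W : Type*} [AddCommGroup V] [Module K V] [Module (PathAlgebra Q K) V]
    [IsScalarTower K (PathAlgebra Q K) V] [Module.Finite K V]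
  [AddCommGroup W] [Module K W] [Module (PathAlgebra Q K) W]
    [IsScalarTower K (PathAlgebra Q K) W] [Module.Finite K W]

theorem of_add_of : (of V : IsoClass Q K) + of W = of (V × W) := by
  obtain ⟨e⟩ := (exists_space_equiv (Q := Q) (K := K) V).choose_spec.choose_spec
  obtain ⟨e'⟩ := (exists_space_equiv (Q := Q) (K := K) W).choose_spec.choose_spec
  exact (of_congr (e.prodCongr e')).symm

end Of

instance : Zero (IsoClass Q K) := ⟨mk (α := 0) fun _ _ _ => 0⟩

theorem exists_of (x : IsoClass Q K) : ∃ (α : Q → ℕ) (M : QuiverRep Q K α), of M.Space = x := by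
  obtain ⟨α, M, rfl⟩ := exists_mk x
  exact ⟨α, M, of_space M⟩

theorem of_eq_zero_iff {V : Type*} [AddCommGroup V] [Module K V] [Module (PathAlgebra Q K) V]
    [IsScalarTower K (PathAlgebra Q K) V] [Module.Finite K V] :
    (of V : IsoClass Q K) = 0 ↔ Subsingleton V := by
  have hs : Subsingleton (Space (Q := Q) (K := K) (α := 0) fun _ _ _ => 0) :=
    inferInstanceAs (Subsingleton (∀ i, Fin 0 → K))
  rw [show (0 : IsoClass Q K) = of (Space (Q := Q) (K := K) (α := 0) fun _ _ _ => 0) from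
    (of_space _).symm, of_eq_of_iff]
  constructor
  · rintro ⟨e⟩
    exact e.toEquiv.subsingleton
  · intro h
    exact ⟨LinearEquiv.ofSubsingleton _ _⟩

noncomputable instance : AddCommMonoid (IsoClass Q K) where
  add_assoc x y z := by
    obtain ⟨α, M, rfl⟩ := exists_of x
    obtain ⟨β, N, rfl⟩ := exists_of y
    obtain ⟨γ, P, rfl⟩ := exists_of z
    rw [of_add_of, of_add_of, of_add_of, of_add_of]
    exact of_congr (LinearEquiv.prodAssoc _ _ _ _)
  zero_add x := by
    obtain ⟨α, M, rfl⟩ := exists_of x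
    have h : (of PUnit : IsoClass Q K) = 0 := of_eq_zero_iff.2 inferInstance
    rw [← h, of_add_of]
    exact of_congr LinearEquiv.uniqueProd
  add_zero x := by
    obtain ⟨α, M, rfl⟩ := exists_of x
    have h : (of PUnit : IsoClass Q K) = 0 := of_eq_zero_iff.2 inferInstance
    rw [← h, of_add_of]
    exact of_congr LinearEquiv.prodUnique
  add_comm x y := by
    obtain ⟨α, M, rfl⟩ := exists_of x
    obtain ⟨β, N, rfl⟩ := exists_of y
    rw [of_add_of, of_add_of]
    exact of_congr (LinearEquiv.prodComm _ _ _)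
  nsmul := nsmulRec

theorem of_pi {V : Type*} [AddCommGroup V] [Module K V] [Module (PathAlgebra Q K) V]
    [IsScalarTower K (PathAlgebra Q K) V] [Module.Finite K V] (n : ℕ) :
    (of (Fin n → V) : IsoClass Q K) = n • of V := by
  induction n with
  | zero => rw [zero_smul]; exact of_eq_zero_iff.2 inferInstance
  | succ n ih =>
    rw [succ_nsmul', ← ih, of_add_of]
    exact of_congr (Fin.consLinearEquiv (PathAlgebra Q K) fun _ => V).symm

theorem isIndec_of_iff {V : Type*} [AddCommGroup V] [Module K V] [Module (PathAlgebra Q K) V]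
    [IsScalarTower K (PathAlgebra Q K) V] [Module.Finite K V] :
    IsIndec (of V : IsoClass Q K) ↔ Nontrivial V ∧
      ∀ P P' : Submodule (PathAlgebra Q K) V, IsCompl P P' → P = ⊥ ∨ P' = ⊥ := by
  refine and_congr (by rw [Ne, of_eq_zero_iff, not_subsingleton_iff_nontrivial])
    ⟨fun h P P' hP => ?_, fun h a b hab => ?_⟩
  · have (P : Submodule (PathAlgebra Q K) V) : Module.Finite K P :=
      inferInstanceAs (Module.Finite K (P.restrictScalars K))
    refine (h (of P) (of P') ?_).imp ?_ ?_
    · rw [of_add_of]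
      exact of_congr (Submodule.prodEquivOfIsCompl P P' hP).symm
    all_goals
      rw [of_eq_zero_iff]
      exact fun h => Submodule.subsingleton_iff_eq_bot.1 h
  · obtain ⟨α, M, rfl⟩ := exists_of a
    obtain ⟨β, N, rfl⟩ := exists_of b
    rw [of_add_of, of_eq_of_iff] at hab
    obtain ⟨e⟩ := hab
    let i : M.Space →ₗ[PathAlgebra Q K] V := e.symm.toLinearMap ∘ₗ LinearMap.inl _ _ _
    let j : N.Space →ₗ[PathAlgebra Q K] V := e.symm.toLinearMap ∘ₗ LinearMap.inr _ _ _
    have hi : Function.Injective i := e.symm.injective.comp LinearMap.inl_injective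
    have hj : Function.Injective j := e.symm.injective.comp LinearMap.inr_injective
    rw [of_eq_zero_iff, of_eq_zero_iff]
    have aux : ∀ {U : Type _} [AddCommGroup U] [Module (PathAlgebra Q K) U]
        (i : U →ₗ[PathAlgebra Q K] V), Function.Injective i → LinearMap.range i = ⊥ →
        Subsingleton U := by
      intro U _ _ i hi h
      rw [LinearMap.range_eq_bot] at h
      exact ⟨fun a b => hi (by rw [h]; rfl)⟩
    refine (h (LinearMap.range i) (LinearMap.range j) ?_).imp (aux i hi) (aux j hj)
    rw [LinearMap.range_comp, LinearMap.range_comp]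
    exact (LinearMap.isCompl_range_inl_inr).map (Submodule.orderIsoMapComap e.symm)

theorem isIndec_mk_iff {M : QuiverRep Q K α} : IsIndec (mk M) ↔ M.IsIndecomposable := by
  rw [← of_space, isIndec_of_iff, isIndecomposable_iff]

/-- Finite dimension over `K` gives finite length over the path algebra, so the exchange property of
modules carries over to classes. -/
theorem exists_exchange (y m n p : IsoClass Q K) (hy : IsIndec y) (h : y + m = n + p) :
    (∃ n', n = y + n' ∧ m = n' + p) ∨ (∃ p', p = y + p' ∧ m = p' + n) := by
  obtain ⟨α, Y, rfl⟩ := exists_of y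
  obtain ⟨β, M, rfl⟩ := exists_of m
  obtain ⟨γ, N, rfl⟩ := exists_of n
  obtain ⟨δ, P, rfl⟩ := exists_of p
  rw [of_add_of, of_add_of, of_eq_of_iff] at h
  obtain ⟨φ⟩ := h
  have : IsArtinian (PathAlgebra Q K) Y.Space := isArtinian_of_tower K inferInstance
  have : IsNoetherian (PathAlgebra Q K) Y.Space := isNoetherian_of_tower K inferInstance
  refine (exchange (isIndec_of_iff.1 hy).2 φ).imp ?_ ?_
  all_goals
    rintro ⟨U, ⟨e⟩, ⟨e'⟩⟩
    have : Module.Finite K U := inferInstanceAs (Module.Finite K (U.restrictScalars K))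
    exact ⟨of U, by rw [of_add_of]; exact of_congr e, by rw [of_add_of]; exact of_congr e'⟩

end IsoClass

/-- The direct sum of two representations. -/
def directSum (M : QuiverRep Q K α) (N : QuiverRep Q K β) : QuiverRep Q K (α + β) :=
  fun i j e => (Matrix.fromBlocks (M i j e) 0 0 (N i j e)).submatrix
    finSumFinEquiv.symm finSumFinEquiv.symm

/-! ### Dimension vectors and unique decomposition -/

namespace IsoClass

/-- An explicit block-diagonal model of the sum, from which additivity of dimension vectors and of
extension of scalars can be read off. -/
theorem mk_directSum (M : QuiverRep Q K α) (N : QuiverRep Q K β) :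
    mk (directSum M N) = mk M + mk N := by
  rw [mk_add_mk, ← of_space]
  let p : (directSum M N).Space →ₗ[PathAlgebra Q K] M.Space :=
    TotalSpace.mapLinear (fun i => LinearMap.funLeft K K (Fin.castAdd (β i))) fun i j e x => by
      ext k
      simp [directSum, Matrix.mulVec, dotProduct, Fin.sum_univ_add, LinearMap.funLeft_apply]
  let q : (directSum M N).Space →ₗ[PathAlgebra Q K] N.Space :=
    TotalSpace.mapLinear (fun i => LinearMap.funLeft K K (Fin.natAdd (α i))) fun i j e x => by
      ext k
      simp [directSum, Matrix.mulVec, dotProduct, Fin.sum_univ_add, LinearMap.funLeft_apply]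
  refine of_congr (LinearEquiv.ofBijective (p.prod q) ⟨fun x y h => ?_, fun x => ?_⟩)
  · ext i k
    refine Fin.addCases (fun k => ?_) (fun k => ?_) k
    · exact congrFun (congrFun (Prod.ext_iff.1 h).1 i) k
    · exact congrFun (congrFun (Prod.ext_iff.1 h).2 i) k
  · refine ⟨fun i => Fin.append (x.1 i) (x.2 i), Prod.ext ?_ ?_⟩
    · ext i k
      exact Fin.append_left _ _ k
    · ext i k
      exact Fin.append_right _ _ k

theorem dim_aux (X Y : Σ α : Q → ℕ, QuiverRep Q K α) (h : (sigmaSetoid Q K).r X Y) :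
    X.1 = Y.1 := h.elim dim_eq_of_equiv

/-- The dimension vector of an isomorphism class. -/
noncomputable def dim : IsoClass Q K →+ (Q → ℕ) where
  toFun := Quotient.lift Sigma.fst dim_aux
  map_zero' := rfl
  map_add' x y := by
    obtain ⟨α, M, rfl⟩ := exists_mk x
    obtain ⟨β, N, rfl⟩ := exists_mk y
    rw [← mk_directSum]
    rfl

@[simp] theorem dim_mk (M : QuiverRep Q K α) : dim (mk M) = α := rfl

theorem exists_mk_of_dim {x : IsoClass Q K} (h : dim x = α) : ∃ M : QuiverRep Q K α, mk M = x := by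
  obtain ⟨α, M, rfl⟩ := exists_mk x
  subst h
  exact ⟨M, rfl⟩

theorem eq_zero_of_dim {x : IsoClass Q K} (h : dim x = 0) : x = 0 := by
  obtain ⟨M, rfl⟩ := exists_mk_of_dim h
  refine congrArg mk (funext fun i => funext fun j => funext fun e => ?_)
  ext k
  exact k.elim0

/-- The total dimension of an isomorphism class. -/
noncomputable def totalDim : IsoClass Q K →+ ℕ where
  toFun x := ∑ i, dim x i
  map_zero' := by simp
  map_add' x y := by simp [Finset.sum_add_distrib]

theorem eq_zero_of_totalDim (x : IsoClass Q K) (h : totalDim x = 0) : x = 0 := by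
  apply eq_zero_of_dim
  ext i
  exact Finset.sum_eq_zero_iff.1 h i (Finset.mem_univ i)

variable (Q K) in
/-- The Krull-Schmidt theorem. -/
theorem bijective_sum :
    Function.Bijective fun s : Multiset {y : IsoClass Q K // IsIndec y} =>
      (s.map Subtype.val).sum :=
  bijective_sum_isIndec totalDim eq_zero_of_totalDim exists_exchange

/-- By Krull–Schmidt, multiplying by `n` multiplies all multiplicities of indecomposables by `n`,
which can be cancelled in `ℕ`. -/
theorem nsmul_injective {n : ℕ} (hn : n ≠ 0) :
    Function.Injective fun x : IsoClass Q K => n • x := by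
  intro x y h
  obtain ⟨s, rfl⟩ := (bijective_sum Q K).2 x
  obtain ⟨t, rfl⟩ := (bijective_sum Q K).2 y
  have : n • s = n • t := (bijective_sum Q K).1 (by
    simpa only [Multiset.map_nsmul, Multiset.sum_nsmul] using h)
  have : s = t := by
    classical
    ext y
    have := congrArg (Multiset.count y) this
    simpa [hn] using this
  rw [this]

end IsoClass

end QuiverRep

/-! ### Extension of scalars -/

namespace QuiverRep

universe w' w''

variable {Q : Type u} [Quiver.{v} Q] [Fintype Q] [DecidableEq Q] {K : Type w} [Field K]
  {L : Type w'} [Field L] {L' : Type w''} [Field L'] {α β : Q → ℕ}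

/-- Extension of scalars along a homomorphism of fields. -/
def mapRep (σ : K →+* L) (M : QuiverRep Q K α) : QuiverRep Q L α := fun i j e => (M i j e).map σ

theorem mapRep_mapRep (σ : K →+* L) (τ : L →+* L') (M : QuiverRep Q K α) :
    (M.mapRep σ).mapRep τ = M.mapRep (τ.comp σ) := rfl

theorem Iso.mapRep {M N : QuiverRep Q K α} (h : Iso M N) (σ : K →+* L) :
    Iso (M.mapRep σ) (N.mapRep σ) := by
  obtain ⟨g, hg⟩ := h
  refine ⟨fun i => Matrix.GeneralLinearGroup.map σ (g i), fun i j e => ?_⟩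
  have := congrArg (fun A => A.map σ) (hg i j e)
  simp only [Matrix.map_mul] at this
  exact this

theorem mapRep_directSum (σ : K →+* L) (M : QuiverRep Q K α) (N : QuiverRep Q K β) :
    (directSum M N).mapRep σ = directSum (M.mapRep σ) (N.mapRep σ) := by
  funext i j e
  refine Matrix.ext fun k l => ?_
  change σ (Matrix.fromBlocks (M i j e) 0 0 (N i j e) (finSumFinEquiv.symm k)
      (finSumFinEquiv.symm l)) =
    Matrix.fromBlocks ((M i j e).map σ) 0 0 ((N i j e).map σ) (finSumFinEquiv.symm k)
      (finSumFinEquiv.symm l)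
  rcases finSumFinEquiv.symm k with k | k <;> rcases finSumFinEquiv.symm l with l | l <;> simp

namespace IsoClass

/-- Extension of scalars on isomorphism classes. -/
noncomputable def map (σ : K →+* L) : IsoClass Q K →+ IsoClass Q L where
  toFun := Quotient.map (fun X => ⟨X.1, X.2.mapRep σ⟩) <| by
    rintro ⟨α, M⟩ ⟨β, N⟩ h
    obtain rfl : α = β := dim_aux _ _ h
    exact nonempty_equiv_iff.2 ((nonempty_equiv_iff.1 h).mapRep σ)
  map_zero' := eq_zero_of_dim rfl
  map_add' x y := by
    obtain ⟨α, M, rfl⟩ := exists_mk x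
    obtain ⟨β, N, rfl⟩ := exists_mk y
    rw [← mk_directSum]
    change mk ((directSum M N).mapRep σ) = mk (M.mapRep σ) + mk (N.mapRep σ)
    rw [mapRep_directSum, mk_directSum]

@[simp] theorem map_mk (σ : K →+* L) (M : QuiverRep Q K α) : map σ (mk M) = mk (M.mapRep σ) := rfl

@[simp] theorem dim_map (σ : K →+* L) (x : IsoClass Q K) : dim (map σ x) = dim x := by
  obtain ⟨α, M, rfl⟩ := exists_mk x
  rfl

theorem map_map (σ : K →+* L) (τ : L →+* L') (x : IsoClass Q K) :
    map τ (map σ x) = map (τ.comp σ) x := by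
  obtain ⟨α, M, rfl⟩ := exists_mk x
  rfl

theorem map_id (x : IsoClass Q K) : map (RingHom.id K) x = x := by
  obtain ⟨α, M, rfl⟩ := exists_mk x
  rfl

/-- The bijection of isomorphism classes attached to an isomorphism of fields. -/
noncomputable def mapEquiv (σ : K ≃+* L) : IsoClass Q K ≃+ IsoClass Q L where
  __ := map σ.toRingHom
  invFun := map σ.symm.toRingHom
  left_inv x := by
    change map _ (map _ x) = x
    rw [map_map, RingEquiv.toRingHom_eq_coe, RingEquiv.toRingHom_eq_coe, RingEquiv.symm_comp,
      map_id]
  right_inv x := by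
    change map _ (map _ x) = x
    rw [map_map, RingEquiv.toRingHom_eq_coe, RingEquiv.toRingHom_eq_coe, RingEquiv.comp_symm,
      map_id]

theorem mapEquiv_apply (σ : K ≃+* L) (x : IsoClass Q K) :
    mapEquiv σ x = map (σ : K →+* L) x := rfl

end IsoClass

theorem _root_.IsIndec.map_equiv {S T : Type*} [AddCommMonoid S] [AddCommMonoid T] (e : S ≃+ T)
    {y : S} (hy : IsIndec y) : IsIndec (e y) := by
  refine ⟨by simpa using hy.1, fun a b hab => ?_⟩
  have := hy.2 (e.symm a) (e.symm b) (by rw [← map_add, ← hab, e.symm_apply_apply])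
  simpa using this

theorem _root_.AddEquiv.isIndec_iff {S T : Type*} [AddCommMonoid S] [AddCommMonoid T] (e : S ≃+ T)
    {y : S} : IsIndec (e y) ↔ IsIndec y :=
  ⟨fun h => by simpa using h.map_equiv e.symm, fun h => h.map_equiv e⟩

/-! ### Restriction of scalars and the Noether–Deuring theorem -/

section Restrict

variable [Algebra K L]

/-- A representation over an extension field, as a module over the path algebra over the base
field. -/
abbrev RestrictSpace (K : Type w) [Field K] [Algebra K L] (M : QuiverRep Q L α) : Type _ :=
  TotalSpace (K := K) (V := fun i => Fin (α i) → L)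
    fun i j e => (M i j e).mulVecLin.restrictScalars K

theorem Iso.nonempty_restrictSpace_equiv {M N : QuiverRep Q L α} (h : Iso M N) :
    Nonempty (M.RestrictSpace K ≃ₗ[PathAlgebra Q K] N.RestrictSpace K) := by
  obtain ⟨g, hg⟩ := h
  refine ⟨TotalSpace.mapEquiv (fun i => (LinearMap.GeneralLinearGroup.toLinearEquiv
    (Matrix.GeneralLinearGroup.toLin (g i))).restrictScalars K) fun i j e x => ?_⟩
  have := congrArg (fun A => A.mulVec x) (hg i j e)
  simpa [Matrix.GeneralLinearGroup.toLin_apply] using this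

/-- Matrices with entries in `K` commute with taking coordinates in a `K`-basis of `L`. -/
theorem nonempty_pi_equiv_restrictSpace {n : ℕ} (b : Module.Basis (Fin n) K L)
    (M : QuiverRep Q K α) :
    Nonempty ((M.mapRep (algebraMap K L)).RestrictSpace K ≃ₗ[PathAlgebra Q K]
      (Fin n → M.Space)) := by
  let p (k : Fin n) : (M.mapRep (algebraMap K L)).RestrictSpace K →ₗ[PathAlgebra Q K] M.Space :=
    TotalSpace.mapLinear (fun i => (b.coord k).compLeft (Fin (α i))) fun i j e x => by
      ext l
      simp [mapRep, Matrix.mulVec, dotProduct, ← Algebra.smul_def]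
  refine ⟨LinearEquiv.ofBijective (LinearMap.pi p) ⟨fun x y h => ?_, fun x => ?_⟩⟩
  · ext i l
    refine b.ext_elem fun k => ?_
    exact congrFun (congrFun (congrFun h k) i) l
  · refine ⟨fun i l => b.equivFun.symm fun k => x k i l, ?_⟩
    ext k i l
    exact congrFun (b.equivFun.apply_symm_apply fun k => x k i l) k

/-- Extending scalars and restricting them back turns `M` into `[L : K]` copies of `M`. Isomorphic
extensions thus give isomorphic multiples, which cancel. -/
theorem IsoClass.map_algebraMap_injective_of_finite [FiniteDimensional K L] :
    Function.Injective (IsoClass.map (Q := Q) (algebraMap K L)) := by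
  intro x y hxy
  obtain ⟨α, M, rfl⟩ := exists_mk x
  obtain ⟨N, rfl⟩ := exists_mk_of_dim (α := α) (x := y) (by
    rw [← dim_map (algebraMap K L) y, ← hxy]; rfl)
  rw [map_mk, map_mk, mk_eq_mk_iff] at hxy
  obtain ⟨e⟩ := hxy.nonempty_restrictSpace_equiv (K := K)
  have b := Module.finBasis K L
  obtain ⟨e₁⟩ := nonempty_pi_equiv_restrictSpace b M
  obtain ⟨e₂⟩ := nonempty_pi_equiv_restrictSpace b N
  have := of_congr ((e₁.symm.trans e).trans e₂)
  rw [of_pi, of_pi, of_space, of_space] at this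
  exact nsmul_injective Module.finrank_pos.ne' this

/-- The Noether-Deuring theorem. -/
theorem IsoClass.map_algebraMap_injective [Algebra.IsAlgebraic K L] :
    Function.Injective (IsoClass.map (Q := Q) (algebraMap K L)) := by
  intro x y hxy
  obtain ⟨α, M, rfl⟩ := exists_mk x
  obtain ⟨N, rfl⟩ := exists_mk_of_dim (α := α) (x := y) (by
    rw [← dim_map (algebraMap K L) y, ← hxy]; rfl)
  rw [map_mk, map_mk, mk_eq_mk_iff] at hxy
  obtain ⟨g, hg⟩ := hxy
  -- An isomorphism over `L` has finitely many matrix entries, so it is already defined over the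
  -- finite subextension `E` that they generate.
  let s : (Σ i, Fin (α i) × Fin (α i)) → L := fun t => (g t.1).1 t.2.1 t.2.2
  let E := IntermediateField.adjoin K (Set.range s)
  have : FiniteDimensional K E := IntermediateField.finiteDimensional_adjoin
    fun x _ => Algebra.IsIntegral.isIntegral x
  have hs : ∀ i k l, (g i).1 k l ∈ E := fun i k l =>
    IntermediateField.subset_adjoin K _ ⟨⟨i, k, l⟩, rfl⟩
  let h (i : Q) : Matrix (Fin (α i)) (Fin (α i)) E := Matrix.of fun k l => ⟨_, hs i k l⟩
  have hh : ∀ i, (h i).map (algebraMap E L) = (g i).1 := fun i => rfl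
  apply map_algebraMap_injective_of_finite (L := E)
  rw [map_mk, map_mk, mk_eq_mk_iff]
  refine ⟨fun i => Matrix.GeneralLinearGroup.mkOfDetNeZero (h i) fun h0 => ?_, fun i j e => ?_⟩
  · apply (g i).det_ne_zero
    have := RingHom.map_det (algebraMap E L) (h i)
    rw [h0, map_zero, RingHom.mapMatrix_apply, hh] at this
    exact this.symm
  · apply Matrix.map_injective (algebraMap E L).injective
    change (h j * M.mapRep (algebraMap K E) i j e).map (algebraMap E L) =
      (N.mapRep (algebraMap K E) i j e * h i).map (algebraMap E L)
    rw [Matrix.map_mul, Matrix.map_mul, hh, hh]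
    exact hg i j e

end Restrict

end QuiverRep

/-! ### Lang's theorem for the general linear group -/

section Lang

variable (K : Type*) [Field K] [Fintype K] {L : Type*} [Field L] [IsAlgClosed L] [Algebra K L]

local notation "q" => Fintype.card K

theorem card_roots_frobenius {m : ℕ} (hm : m ≠ 0) :
    ∃ s : Finset L, s.card = q ^ m ∧ ∀ c ∈ s, c ^ q ^ m = c := by
  classical
  obtain ⟨p, hp, n, hp', hpn⟩ := FiniteField.card' K
  have : CharP L p := charP_of_injective_algebraMap' K p
  have hsep : (X ^ q ^ m - X : L[X]).Separable :=
    galois_poly_separable p _ (by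
      rw [hpn]; exact dvd_pow (dvd_pow_self p n.ne_zero) hm)
  refine ⟨(X ^ q ^ m - X : L[X]).roots.toFinset, ?_, fun c hc => ?_⟩
  · rw [Multiset.toFinset_card_of_nodup (nodup_roots hsep),
      ← (IsAlgClosed.splits _).natDegree_eq_card_roots,
      FiniteField.X_pow_card_pow_sub_X_natDegree_eq L hm Fintype.one_lt_card]
  · have := (mem_roots'.1 (Multiset.mem_toFinset.1 hc)).2
    simpa [sub_eq_zero] using this

/-- The sum is a polynomial in `c` of degree at most `q ^ (m - 1)` with `q ^ m` zeros, hence zero;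
its coefficient at `X` is `b 0`. -/
theorem eq_zero_of_sum_mul_pow_frobenius {m : ℕ} (hm : m ≠ 0) (b : ℕ → L)
    (h : ∀ c : L, c ^ q ^ m = c → ∑ i ∈ Finset.range m, b i * c ^ q ^ i = 0) : b 0 = 0 := by
  obtain ⟨s, hs, hsc⟩ := card_roots_frobenius K (L := L) hm
  have hq : 1 < q := Fintype.one_lt_card
  have h0 : (∑ i ∈ Finset.range m, C (b i) * X ^ q ^ i : L[X]) = 0 := by
    refine eq_zero_of_natDegree_lt_card_of_eval_eq_zero' _ s (fun c hc => ?_) ?_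
    · simpa [eval_finsetSum] using h c (hsc c hc)
    · rw [hs]
      refine lt_of_le_of_lt (natDegree_sum_le_of_forall_le (n := q ^ (m - 1)) _ _ fun i hi => ?_)
        (Nat.pow_lt_pow_right hq (by omega))
      refine (natDegree_C_mul_X_pow_le _ _).trans (Nat.pow_le_pow_right hq.le ?_)
      have := Finset.mem_range.1 hi
      omega
  have h1 := congrArg (fun P => coeff P 1) h0
  simp only [finsetSum_coeff, coeff_C_mul, coeff_X_pow, coeff_zero] at h1
  rw [Finset.sum_eq_single 0] at h1
  · simpa using h1
  · intro i _ hi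
    rw [if_neg, mul_zero]
    exact (Nat.one_lt_pow hi hq).ne
  · intro h
    exact absurd (Finset.mem_range.2 (Nat.pos_of_ne_zero hm)) h

variable {n : Type*} [Fintype n] [DecidableEq n]

/-- The semilinear map `v ↦ σ(v) A`, where `σ` is the Frobenius map. -/
def frobeniusTwist (A : Matrix n n L) : (n → L) →+ (n → L) where
  toFun v := Matrix.vecMul (fun k => FiniteField.frobeniusAlgHom K L (v k)) A
  map_zero' := by
    simp only [Pi.zero_apply, map_zero]
    exact Matrix.zero_vecMul A
  map_add' v w := by
    simp only [Pi.add_apply, map_add]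
    exact Matrix.add_vecMul A _ _

theorem frobeniusTwist_apply (A : Matrix n n L) (v : n → L) :
    frobeniusTwist K A v = Matrix.vecMul (fun k => FiniteField.frobeniusAlgHom K L (v k)) A := rfl

theorem frobeniusTwist_smul (A : Matrix n n L) (c : L) (v : n → L) :
    frobeniusTwist K A (c • v) = c ^ q • frobeniusTwist K A v := by
  rw [frobeniusTwist_apply, frobeniusTwist_apply, ← Matrix.smul_vecMul]
  congr 1
  ext k
  simp [mul_pow]

theorem frobeniusTwist_iterate_smul (A : Matrix n n L) (c : L) (v : n → L) (i : ℕ) :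
    (frobeniusTwist K A)^[i] (c • v) = c ^ q ^ i • (frobeniusTwist K A)^[i] v := by
  induction i with
  | zero => simp
  | succ i ih =>
    rw [Function.iterate_succ_apply', Function.iterate_succ_apply', ih, frobeniusTwist_smul,
      ← pow_mul, pow_succ]

theorem frobeniusTwist_injective {A : Matrix n n L} (hA : IsUnit A) :
    Function.Injective (frobeniusTwist K A) := by
  intro v w h
  have := Matrix.vecMul_injective_of_isUnit hA h
  ext k
  exact (FiniteField.frobeniusAlgHom K L).injective (congrFun this k)

/-- The entries of `A` generate a finite field `E`. The twist maps the finite set of vectors over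
`E` injectively to itself, so each of them is periodic. -/
theorem exists_iterate_frobeniusTwist_eq [Algebra.IsAlgebraic K L] {A : Matrix n n L}
    (hA : IsUnit A) (k : n) :
    ∃ m ≠ 0, (frobeniusTwist K A)^[m] (Pi.single k 1) = Pi.single k 1 := by
  let E := IntermediateField.adjoin K (Set.range fun t : n × n => A t.1 t.2)
  have : FiniteDimensional K E := IntermediateField.finiteDimensional_adjoin
    fun x _ => Algebra.IsIntegral.isIntegral x
  have : Finite E := Module.finite_of_finite K
  have hAE : ∀ k l, A k l ∈ E := fun k l => IntermediateField.subset_adjoin K _ ⟨(k, l), rfl⟩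
  let T := {v : n → L // ∀ k, v k ∈ E}
  have : Finite T := Finite.of_injective (fun v : T => fun k => (⟨v.1 k, v.2 k⟩ : E)) <| by
    intro v w h
    ext k
    exact congrArg Subtype.val (congrFun h k)
  let φ : T → T := fun v => ⟨frobeniusTwist K A v.1, fun l => by
    rw [frobeniusTwist_apply]
    exact sum_mem fun j _ => mul_mem (by simpa using pow_mem (v.2 j) _) (hAE j l)⟩
  have hφ : Function.Injective φ := fun v w h =>
    Subtype.ext (frobeniusTwist_injective K hA (congrArg Subtype.val h))
  let e : T := ⟨Pi.single k 1, fun l => by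
    rcases eq_or_ne l k with rfl | h
    · simp
    · simp [h]⟩
  obtain ⟨m, hm, hme⟩ := Function.mem_periodicPts.1 (hφ.mem_periodicPts e)
  have hval : ∀ i, ((φ^[i] e).1) = (frobeniusTwist K A)^[i] e.1 := by
    intro i
    induction i with
    | zero => rfl
    | succ i ih => rw [Function.iterate_succ_apply', Function.iterate_succ_apply', ← ih]
  exact ⟨m, hm.ne', by rw [← hval, hme]⟩

/-- Write T for the twist. If T^m fixes the basis vector e_k and c^(q^m) = c, then the trace Σ T^i(c
e_k) over i < m is a fixed vector. A functional f that kills all fixed vectors satisfies Σ c^(q^i)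
f(T^i e_k) = 0 for all such c, which forces f(e_k) = 0. -/
theorem span_fixed_frobeniusTwist [Algebra.IsAlgebraic K L] {A : Matrix n n L} (hA : IsUnit A) :
    Submodule.span L {v | frobeniusTwist K A v = v} = ⊤ := by
  by_contra hne
  obtain ⟨f, hf0, hf⟩ := Submodule.exists_le_ker_of_lt_top _ (lt_top_iff_ne_top.2 hne)
  apply hf0
  refine LinearMap.pi_ext' fun k => LinearMap.ext_ring ?_
  obtain ⟨m, hm, hk⟩ := exists_iterate_frobeniusTwist_eq K hA k
  refine eq_zero_of_sum_mul_pow_frobenius K hm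
    (fun i => f ((frobeniusTwist K A)^[i] (Pi.single k 1))) fun c hc => ?_
  have hmem : ∑ i ∈ Finset.range m, (frobeniusTwist K A)^[i] (c • Pi.single k 1) ∈
      Submodule.span L {v | frobeniusTwist K A v = v} := by
    refine Submodule.subset_span ?_
    change frobeniusTwist K A _ = _
    rw [map_sum]
    simp only [← Function.iterate_succ_apply']
    have h1 := Finset.sum_range_succ (fun i => (frobeniusTwist K A)^[i] (c • Pi.single k 1)) m
    have h2 := Finset.sum_range_succ' (fun i => (frobeniusTwist K A)^[i] (c • Pi.single k 1)) m
    rw [frobeniusTwist_iterate_smul, hk, hc] at h1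
    exact add_right_cancel (h2.symm.trans h1)
  have := hf hmem
  rw [LinearMap.mem_ker, map_sum] at this
  rw [← this]
  refine Finset.sum_congr rfl fun i _ => ?_
  rw [frobeniusTwist_iterate_smul, map_smul, smul_eq_mul, mul_comm]

/-- Lang's theorem for the general linear group. -/
theorem exists_map_frobenius_eq_mul [Algebra.IsAlgebraic K L] (g : GL n L) :
    ∃ h : GL n L, Matrix.GeneralLinearGroup.map (FiniteField.frobeniusAlgHom K L).toRingHom h =
      h * g := by
  -- The equation to solve is σ(h) g⁻¹ = h, which says that the rows of `h` are fixed by the twist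
  -- with `g⁻¹`. A basis of fixed vectors gives an invertible solution.
  have hA : IsUnit (g⁻¹ : GL n L).1 := (g⁻¹).isUnit
  obtain ⟨b, hb, hspan, hli⟩ := exists_linearIndependent L {v | frobeniusTwist K (g⁻¹).1 v = v}
  rw [span_fixed_frobeniusTwist K hA] at hspan
  let B : Module.Basis b L (n → L) := Module.Basis.mk hli (by simp [hspan])
  let B' := B.reindex (B.indexEquiv (Pi.basisFun L n))
  have hB' : ∀ k, frobeniusTwist K (g⁻¹).1 (B' k) = B' k := by
    intro k
    have : B' k ∈ b := by simp [B', B]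
    exact hb this
  let A : Matrix n n L := Matrix.of fun k => B' k
  have hAu : IsUnit A := Matrix.linearIndependent_rows_iff_isUnit.1 B'.linearIndependent
  obtain ⟨h, hh⟩ := hAu
  refine ⟨h, ?_⟩
  rw [← mul_inv_eq_iff_eq_mul]
  refine Units.ext (Matrix.ext fun k l => ?_)
  have := congrFun (hB' k) l
  change (h.1.map (FiniteField.frobeniusAlgHom K L) * (g⁻¹).1) k l = h.1 k l
  rw [hh]
  exact this

/-- The elements of `K` already give `q` roots of `X ^ q - X`, so there is no room for another. -/
theorem mem_range_algebraMap_of_pow_card {c : L} (h : c ^ q = c) : c ∈ (algebraMap K L).range := by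
  classical
  by_contra hc
  have hq : 1 < q := Fintype.one_lt_card
  have hc' : c ∉ Finset.univ.image (algebraMap K L) := by
    simpa using hc
  have := eq_zero_of_natDegree_lt_card_of_eval_eq_zero' (X ^ q - X : L[X])
    (insert c (Finset.univ.image (algebraMap K L))) (fun x hx => ?_) ?_
  · exact FiniteField.X_pow_card_sub_X_ne_zero L hq this
  · rcases Finset.mem_insert.1 hx with rfl | hx
    · simp [h]
    · obtain ⟨y, -, rfl⟩ := Finset.mem_image.1 hx
      simp [← map_pow, FiniteField.pow_card]
  · rw [Finset.card_insert_of_notMem hc',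
      Finset.card_image_of_injective _ (algebraMap K L).injective, Finset.card_univ,
      FiniteField.X_pow_card_sub_X_natDegree_eq L hq]
    exact Nat.lt_succ_self _

end Lang

/-! ### Descent of isomorphism classes to a finite field -/

namespace QuiverRep.IsoClass

variable {Q : Type u} [Quiver.{v} Q] [Fintype Q] [DecidableEq Q] (K : Type*) [Field K] [Fintype K]
  {L : Type*} [Field L] [IsAlgClosed L] [Algebra K L] [Algebra.IsAlgebraic K L]

/-- An isomorphism class is defined over a finite field if it is fixed by the Frobenius map. -/
theorem mem_range_map_iff (x : IsoClass Q L) :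
    x ∈ Set.range (map (Q := Q) (algebraMap K L)) ↔
      map (FiniteField.frobeniusAlgHom K L).toRingHom x = x := by
  constructor
  · rintro ⟨y, rfl⟩
    rw [map_map]
    congr 2
    exact (FiniteField.frobeniusAlgHom K L).comp_algebraMap
  · obtain ⟨α, M, rfl⟩ := exists_mk x
    intro hx
    rw [map_mk, mk_eq_mk_iff] at hx
    obtain ⟨g, hg⟩ := hx
    -- Here `g` carries σ(M) to M and σ(h) = h g, so the conjugate `N` of `M` by `h` is fixed by σ
    -- entry by entry and has its entries in `K`.
    choose h hh using fun i => exists_map_frobenius_eq_mul K (g i)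
    let σ := (FiniteField.frobeniusAlgHom K L).toRingHom
    let N : QuiverRep Q L α := fun i j e => (h j).1 * M i j e * (h i)⁻¹.1
    have hN : N.mapRep σ = N := by
      funext i j e
      have h1 : ∀ i, (h i).1.map σ = (h i).1 * (g i).1 := fun i => congrArg Units.val (hh i)
      have h2 : (h i)⁻¹.1.map σ = (g i)⁻¹.1 * (h i)⁻¹.1 := by
        rw [← Units.val_mul, ← mul_inv_rev, ← hh, ← map_inv]
        rfl
      change ((h j).1 * M i j e * (h i)⁻¹.1).map σ = (h j).1 * M i j e * (h i)⁻¹.1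
      have h3 : (g j).1 * (M i j e).map σ = M i j e * (g i).1 := hg i j e
      rw [Matrix.map_mul, Matrix.map_mul, h1, h2, Matrix.mul_assoc (h j).1, h3, Matrix.mul_assoc,
        Matrix.mul_assoc, ← Matrix.mul_assoc (g i).1, ← Units.val_mul, mul_inv_cancel,
        Units.val_one, Matrix.one_mul, Matrix.mul_assoc]
    have hc : ∀ i j (e : i ⟶ j) k l, ∃ c : K, algebraMap K L c = N i j e k l := fun i j e k l =>
      mem_range_algebraMap_of_pow_card K
        (congrFun (congrFun (congrFun (congrFun (congrFun hN i) j) e) k) l)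
    choose c hc using hc
    let N' : QuiverRep Q K α := fun i j e => Matrix.of (c i j e)
    have hN' : N'.mapRep (algebraMap K L) = N :=
      funext fun i => funext fun j => funext fun e => Matrix.ext fun k l => hc i j e k l
    refine ⟨mk N', ?_⟩
    rw [map_mk, hN', mk_eq_mk_iff]
    refine Iso.symm ⟨h, fun i j e => ?_⟩
    change _ = (h j).1 * M i j e * (h i)⁻¹.1 * (h i).1
    rw [Matrix.mul_assoc _ _ (h i).1, ← Units.val_mul, inv_mul_cancel, Units.val_one,
      Matrix.mul_one]

end QuiverRep.IsoClass

/-! ### Counting invariant multisets -/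

section InvariantMultiset

variable {Y : Type*} {A : Type*} [AddCommMonoid A]

/-- The first `k` iterates of a map, as a multiset. -/
def iterateMultiset (τ : Y → Y) (k : ℕ) (y : Y) : Multiset Y :=
  (Multiset.range k).map fun i => τ^[i] y

theorem card_iterateMultiset (τ : Y → Y) (k : ℕ) (y : Y) :
    (iterateMultiset τ k y).card = k := by simp [iterateMultiset]

theorem iterateMultiset_succ (τ : Y → Y) (k : ℕ) (y : Y) :
    iterateMultiset τ (k + 1) y = τ^[k] y ::ₘ iterateMultiset τ k y := by
  simp [iterateMultiset, Multiset.range_succ]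

theorem iterateMultiset_succ' (τ : Y → Y) (k : ℕ) (y : Y) :
    iterateMultiset τ (k + 1) y = y ::ₘ (iterateMultiset τ k y).map τ := by
  induction k with
  | zero => simp [iterateMultiset]
  | succ k ih =>
    rw [iterateMultiset_succ, ih, Multiset.cons_swap, Function.iterate_succ_apply',
      ← Multiset.map_cons, ← iterateMultiset_succ, ih]

/-- The list from `y` to `τ^[k] y` can be shortened at either end; the two shortened lists agree as
multisets when the end points do. -/
theorem map_iterateMultiset {τ : Y → Y} {k : ℕ} {y : Y} (h : τ^[k] y = y) :
    (iterateMultiset τ k y).map τ = iterateMultiset τ k y := by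
  have := (iterateMultiset_succ τ k y).symm.trans (iterateMultiset_succ' τ k y)
  rw [h] at this
  exact ((Multiset.cons_inj_right y).1 this).symm

theorem iterateMultiset_add (τ : Y → Y) (k l : ℕ) (y : Y) :
    iterateMultiset τ (k + l) y = iterateMultiset τ k y + iterateMultiset τ l (τ^[k] y) := by
  induction l with
  | zero => simp [iterateMultiset]
  | succ l ih =>
    rw [← add_assoc, iterateMultiset_succ, ih, iterateMultiset_succ, Multiset.add_cons,
      ← Function.iterate_add_apply, add_comm l k]

theorem iterateMultiset_mul {τ : Y → Y} {r : ℕ} {y : Y} (h : τ^[r] y = y) (m : ℕ) :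
    iterateMultiset τ (r * m) y = m • iterateMultiset τ r y := by
  induction m with
  | zero => simp [iterateMultiset]
  | succ m ih =>
    have : τ^[r * m] y = y := by
      rw [Function.iterate_mul]
      exact Function.IsFixedPt.iterate h m
    rw [Nat.mul_succ, iterateMultiset_add, ih, this, succ_nsmul]

theorem sum_map_iterateMultiset {τ : Y → Y} {wt : Y → A} (hwt : ∀ y, wt (τ y) = wt y) (k : ℕ)
    (y : Y) : ((iterateMultiset τ k y).map wt).sum = k • wt y := by
  have h : ∀ i, wt (τ^[i] y) = wt y := by
    intro i
    induction i with
    | zero => rfl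
    | succ i ih => rw [Function.iterate_succ_apply', hwt, ih]
  simp [iterateMultiset, h]

variable [DecidableEq Y]

theorem count_iterate_of_map_eq {τ : Y → Y} (hτ : Function.Injective τ) {s : Multiset Y}
    (hs : s.map τ = s) (i : ℕ) (y : Y) : s.count (τ^[i] y) = s.count y := by
  induction i with
  | zero => rfl
  | succ i ih =>
    rw [Function.iterate_succ_apply', ← ih]
    conv_lhs => rw [← hs]
    exact Multiset.count_map_eq_count' τ s hτ _

/-- All iterates of `y` lie in the finite support of `s`, so two of them coincide, and injectivity
cancels the common initial part. -/
theorem mem_periodicPts_of_mem {τ : Y → Y} (hτ : Function.Injective τ) {s : Multiset Y}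
    (hs : s.map τ = s) {y : Y} (hy : y ∈ s) : y ∈ Function.periodicPts τ := by
  have hmaps : ∀ i, τ^[i] y ∈ s := fun i => by
    rwa [← Multiset.one_le_count_iff_mem, count_iterate_of_map_eq hτ hs,
      Multiset.one_le_count_iff_mem]
  obtain ⟨i, j, hij, h⟩ := Finite.exists_ne_map_eq_of_infinite
    fun i : ℕ => (⟨τ^[i] y, Multiset.mem_toFinset.2 (hmaps i)⟩ : s.toFinset)
  have h : τ^[i] y = τ^[j] y := congrArg Subtype.val h
  wlog hlt : i < j generalizing i j
  · exact this j i hij.symm (by simp_all) h.symm (by omega)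
  refine Function.mk_mem_periodicPts (n := j - i) (by omega) (hτ.iterate i ?_)
  rw [← Function.iterate_add_apply, h]
  congr 2
  omega

/-- Multiplicities in `s` are constant along the orbit of `y`, and the walk passes `m` times through
each of its points. -/
theorem iterateMultiset_le_iff {τ : Y → Y} (hτ : Function.Injective τ) {s : Multiset Y}
    (hs : s.map τ = s) {y : Y} (hy : y ∈ Function.periodicPts τ) (m : ℕ) :
    iterateMultiset τ (Function.minimalPeriod τ y * m) y ≤ s ↔ m ≤ s.count y := by
  set r := Function.minimalPeriod τ y
  have hr : 0 < r := Function.minimalPeriod_pos_of_mem_periodicPts hy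
  have hper : τ^[r] y = y := Function.isPeriodicPt_minimalPeriod τ y
  have hnodup : (iterateMultiset τ r y).Nodup := by
    refine Multiset.Nodup.map_on (fun i hi j hj h => ?_) (Multiset.nodup_range r)
    exact Function.iterate_injOn_Iio_minimalPeriod (Multiset.mem_range.1 hi)
      (Multiset.mem_range.1 hj) h
  have hmem : y ∈ iterateMultiset τ r y :=
    Multiset.mem_map.2 ⟨0, Multiset.mem_range.2 hr, rfl⟩
  rw [iterateMultiset_mul hper, Multiset.le_iff_count]
  constructor
  · intro h
    have := h y
    rwa [Multiset.count_nsmul, Multiset.count_eq_one_of_mem hnodup hmem, mul_one] at this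
  · intro h z
    rw [Multiset.count_nsmul]
    by_cases hz : z ∈ iterateMultiset τ r y
    · rw [Multiset.count_eq_one_of_mem hnodup hz, mul_one]
      obtain ⟨i, -, rfl⟩ := Multiset.mem_map.1 hz
      rwa [count_iterate_of_map_eq hτ hs]
    · rw [Multiset.count_eq_zero_of_notMem hz, mul_zero]
      exact Nat.zero_le _

/-- The cycles of an injective map which are contained in an invariant multiset, counted with
their lengths and starting points. -/
abbrev CycleIn (τ : Y → Y) (s : Multiset Y) : Type _ :=
  {x : ℕ × Y // 0 < x.1 ∧ τ^[x.1] x.2 = x.2 ∧ iterateMultiset τ x.1 x.2 ≤ s}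

/-- A point `y` of minimal period r starts the cycles of length r, 2r, …, up to its multiplicity
times r, so it contributes exactly its multiplicity. -/
theorem card_cycleIn {τ : Y → Y} (hτ : Function.Injective τ) {s : Multiset Y}
    (hs : s.map τ = s) : Nat.card (CycleIn τ s) = s.card := by
  have hper : ∀ y : s.toFinset, y.1 ∈ Function.periodicPts τ := fun y =>
    mem_periodicPts_of_mem hτ hs (Multiset.mem_toFinset.1 y.2)
  let f : (Σ y : s.toFinset, Fin (s.count y.1)) → CycleIn τ s := fun t =>
    ⟨(Function.minimalPeriod τ t.1.1 * (t.2 + 1), t.1.1),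
      Nat.mul_pos (Function.minimalPeriod_pos_of_mem_periodicPts (hper t.1)) (Nat.succ_pos _),
      (Function.isPeriodicPt_minimalPeriod τ t.1.1).mul_const _,
      (iterateMultiset_le_iff hτ hs (hper t.1) _).2 t.2.2⟩
  have hf : Function.Bijective f := by
    constructor
    · rintro ⟨⟨y, hy⟩, j⟩ ⟨⟨y', hy'⟩, j'⟩ h
      have h := congrArg Subtype.val h
      obtain ⟨h1, h2⟩ := Prod.ext_iff.1 h
      change y = y' at h2
      subst h2
      have := Nat.eq_of_mul_eq_mul_left
        (Function.minimalPeriod_pos_of_mem_periodicPts (hper ⟨y, hy⟩)) h1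
      have : j = j' := Fin.ext (Nat.succ_injective this)
      subst this
      rfl
    · rintro ⟨⟨k, y⟩, hk, hky, hle⟩
      have hy : y ∈ s := Multiset.mem_of_le hle
        (Multiset.mem_map.2 ⟨0, Multiset.mem_range.2 hk, rfl⟩)
      obtain ⟨m, rfl⟩ := (show Function.IsPeriodicPt τ k y from hky).minimalPeriod_dvd
      have hm := (iterateMultiset_le_iff hτ hs (mem_periodicPts_of_mem hτ hs hy) m).1 hle
      have hm0 : m ≠ 0 := by
        rintro rfl
        simp at hk
      obtain ⟨j, rfl⟩ := Nat.exists_eq_succ_of_ne_zero hm0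
      exact ⟨⟨⟨y, Multiset.mem_toFinset.2 hy⟩, ⟨j, hm⟩⟩, rfl⟩
  rw [← Nat.card_eq_of_bijective f hf, Nat.card_sigma, ← Multiset.toFinset_sum_count_eq s]
  simp only [Nat.card_eq_fintype_card, Fintype.card_fin]
  exact Finset.sum_coe_sort s.toFinset fun y => s.count y

/-- Invariant multisets of given cardinality and weight. -/
abbrev InvMultiset (τ : Y → Y) (wt : Y → A) (N : ℕ) (α : A) : Type _ :=
  {s : Multiset Y // s.map τ = s ∧ s.card = N ∧ (s.map wt).sum = α}

/-- Points fixed by an iterate, of given total weight along the iterates. -/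
abbrev IterateFixed (τ : Y → Y) (wt : Y → A) (k : ℕ) (δ : A) : Type _ :=
  {y : Y // τ^[k] y = y ∧ k • wt y = δ}

/-- Newton's identity for the numbers of invariant multisets. -/
theorem newton_invMultiset [Finset.HasAntidiagonal A] {τ : Y → Y} (hτ : Function.Injective τ)
    {wt : Y → A} (hwt : ∀ y, wt (τ y) = wt y) (hH : ∀ N α, Finite (InvMultiset τ wt N α))
    (hB : ∀ k δ, Finite (IterateFixed τ wt (k + 1) δ)) (N : ℕ) (α : A) :
    (N + 1) * Nat.card (InvMultiset τ wt (N + 1) α) =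
      ∑ k : Fin (N + 1), ∑ x ∈ Finset.HasAntidiagonal.antidiagonal α,
        Nat.card (IterateFixed τ wt (k + 1) x.1) * Nat.card (InvMultiset τ wt (N - k) x.2) := by
  -- Double counting: adding a closed walk of length `k + 1` to an invariant multiset with `N - k`
  -- elements produces each pair of an invariant multiset with `N + 1` elements and a cycle in it
  -- exactly once.
  let f : (Σ k : Fin (N + 1), Σ x : Finset.HasAntidiagonal.antidiagonal α,
        IterateFixed τ wt (k + 1) x.1.1 × InvMultiset τ wt (N - k) x.1.2) →
      Σ s : InvMultiset τ wt (N + 1) α, CycleIn τ s.1 := fun t =>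
    ⟨⟨t.2.2.2.1 + iterateMultiset τ (t.1 + 1) t.2.2.1.1, by
        rw [Multiset.map_add, t.2.2.2.2.1, map_iterateMultiset t.2.2.1.2.1], by
        rw [Multiset.card_add, t.2.2.2.2.2.1, card_iterateMultiset]
        have := t.1.2
        omega, by
        rw [Multiset.map_add, Multiset.sum_add, t.2.2.2.2.2.2, sum_map_iterateMultiset hwt,
          t.2.2.1.2.2, add_comm]
        exact Finset.HasAntidiagonal.mem_antidiagonal.1 t.2.1.2⟩,
      ⟨(t.1 + 1, t.2.2.1.1), Nat.succ_pos _, t.2.2.1.2.1, Multiset.le_add_left _ _⟩⟩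
  have hf : Function.Bijective f := by
    constructor
    · rintro ⟨⟨k, hk⟩, ⟨⟨δ, γ⟩, hx⟩, ⟨y, hy, hδ⟩, ⟨s, hs, hsN, hγ⟩⟩
        ⟨⟨k', hk'⟩, ⟨⟨δ', γ'⟩, hx'⟩, ⟨y', hy', hδ'⟩, ⟨s', hs', hsN', hγ'⟩⟩ h
      simp only at hδ hγ hδ' hγ'
      have h1 : s + iterateMultiset τ (k + 1) y = s' + iterateMultiset τ (k' + 1) y' :=
        congrArg (fun t => t.1.1) h
      have h2 : k + 1 = k' + 1 := congrArg (fun t => t.2.1.1) h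
      have h3 : y = y' := congrArg (fun t => t.2.1.2) h
      obtain rfl : k = k' := by omega
      subst h3
      obtain rfl : s = s' := add_right_cancel h1
      subst hδ hγ hδ' hγ'
      rfl
    · rintro ⟨⟨s, hs, hsN, hα⟩, ⟨⟨k, y⟩, hk, hy, hle⟩⟩
      obtain ⟨k, rfl⟩ := Nat.exists_eq_succ_of_ne_zero hk.ne'
      obtain ⟨s', rfl⟩ := Multiset.le_iff_exists_add.1 hle
      simp only [Nat.succ_eq_add_one] at hy hle hs hsN hα
      rw [Multiset.card_add, card_iterateMultiset] at hsN
      rw [Multiset.map_add, map_iterateMultiset hy] at hs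
      rw [Multiset.map_add, Multiset.sum_add, sum_map_iterateMultiset hwt] at hα
      refine ⟨⟨⟨k, by omega⟩, ⟨((k + 1) • wt y, (s'.map wt).sum),
        Finset.HasAntidiagonal.mem_antidiagonal.2 hα⟩, ⟨y, hy, rfl⟩,
        ⟨s', add_left_cancel hs, by simp only; omega, rfl⟩⟩, ?_⟩
      have aux : ∀ {s t : InvMultiset τ wt (N + 1) α} (h : s = t) (c : CycleIn τ s.1)
          (d : CycleIn τ t.1), c.1 = d.1 → (⟨s, c⟩ : Σ s : InvMultiset τ wt (N + 1) α,
            CycleIn τ s.1) = ⟨t, d⟩ := by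
        rintro s _ rfl c d h
        rw [Subtype.ext h]
      exact aux (Subtype.ext (add_comm _ _)) _ _ rfl
  have hfin : ∀ s : InvMultiset τ wt (N + 1) α, Nat.card (CycleIn τ s.1) = N + 1 := fun s =>
    (card_cycleIn hτ s.2.1).trans s.2.2.1
  -- An infinite type has `Nat.card` equal to `0`, so the nonzero value gives finiteness.
  have : ∀ s : InvMultiset τ wt (N + 1) α, Finite (CycleIn τ s.1) := fun s =>
    Nat.finite_of_card_ne_zero (by rw [hfin]; omega)
  have := Fintype.ofFinite (InvMultiset τ wt (N + 1) α)
  have h := Nat.card_eq_of_bijective f hf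
  rw [Nat.card_sigma, Nat.card_sigma] at h
  simp only [hfin, Finset.sum_const, Finset.card_univ, smul_eq_mul] at h
  rw [mul_comm, Nat.card_eq_fintype_card, ← h]
  refine Finset.sum_congr rfl fun k _ => ?_
  rw [Nat.card_sigma]
  simp only [Nat.card_prod]
  exact (Finset.sum_coe_sort (Finset.HasAntidiagonal.antidiagonal α) fun x =>
    Nat.card (IterateFixed τ wt (k + 1) x.1) * Nat.card (InvMultiset τ wt (N - k) x.2))

end InvariantMultiset

/-! ### The plethystic exponential of a counting function -/

section PlethExp

open LambdaRing

variable {ι Y : Type*} [DecidableEq Y] {τ : Y → Y} {wt : Y → ι →₀ ℕ}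
  {a : MvPowerSeries ι (ℕ+ → ℚ)}

/-- The Adams operation of index `k + 1` replaces `τ^[n]` by its `(k + 1)`-st iterate and multiplies
weights by `k + 1`; exponents not divisible by `k + 1` have coefficient zero. -/
theorem coeff_adamsPowerSeries
    (ha : ∀ β (n : ℕ+), MvPowerSeries.coeff β a n =
      Nat.card {y // τ^[(n : ℕ)] y = y ∧ wt y = β}) (k : ℕ) (n : ℕ+) (δ : ι →₀ ℕ) :
    MvPowerSeries.coeff δ (adamsPowerSeries adamsFun (Nat.succPNat k) a) n =
      Nat.card (IterateFixed τ^[(n : ℕ)] wt (k + 1) δ) := by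
  change adamsFun (Nat.succPNat k)
    (MvPowerSeries.coeff δ (MvPowerSeries.expand (k + 1) k.succ_ne_zero a)) n = _
  by_cases h : ∃ β, δ = (k + 1) • β
  · obtain ⟨β, rfl⟩ := h
    rw [MvPowerSeries.coeff_expand_smul]
    change MvPowerSeries.coeff β a (Nat.succPNat k * n) = _
    rw [ha]
    refine congrArg Nat.cast (Nat.card_congr (Equiv.subtypeEquivRight fun y => ?_))
    rw [PNat.mul_coe, Nat.succPNat_coe, mul_comm, Function.iterate_mul]
    refine and_congr_right fun _ => ?_
    constructor
    · rintro rfl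
      rfl
    · intro h
      ext i
      have := DFunLike.congr_fun h i
      simpa using this
  · have h' : ∃ i, ¬ (k + 1) ∣ δ i := by
      by_contra! hcon
      refine h ⟨δ.mapRange (fun x => x / (k + 1)) (Nat.zero_div _), ?_⟩
      ext i
      simpa using (Nat.mul_div_cancel' (hcon i)).symm
    obtain ⟨i, hi⟩ := h'
    rw [MvPowerSeries.coeff_expand_of_not_dvd _ _ _ hi, map_zero]
    have : IsEmpty (IterateFixed τ^[(n : ℕ)] wt (k + 1) δ) :=
      ⟨fun y => h ⟨_, y.2.2.symm⟩⟩
    simp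

/-- Both sides obey Newton's recursion, the left by definition and the right by
`newton_invMultiset`; at `N = 0` only the empty multiset, of weight zero, counts. -/
theorem coeff_sigma (hinj : Function.Injective τ) (hwt : ∀ y, wt (τ y) = wt y)
    (ha : ∀ β (n : ℕ+), MvPowerSeries.coeff β a n =
      Nat.card {y // τ^[(n : ℕ)] y = y ∧ wt y = β})
    (hH : ∀ (n : ℕ+) N α, Finite (InvMultiset τ^[(n : ℕ)] wt N α))
    (hB : ∀ (n : ℕ+) β, Finite {y // τ^[(n : ℕ)] y = y ∧ wt y = β}) (N : ℕ) (α : ι →₀ ℕ)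
    (n : ℕ+) : MvPowerSeries.coeff α (sigma (adamsPowerSeries adamsFun) a N) n =
      Nat.card (InvMultiset τ^[(n : ℕ)] wt N α) := by
  classical
  induction N using Nat.strong_induction_on generalizing α with
  | _ N ih =>
    rcases N with _ | N
    · rw [sigma, MvPowerSeries.coeff_one]
      split_ifs with h
      · subst h
        have : Unique (InvMultiset τ^[(n : ℕ)] wt 0 0) :=
          { default := ⟨0, by simp⟩
            uniq := fun s => Subtype.ext (Multiset.card_eq_zero.1 s.2.2.1) }
        simp
      · have : IsEmpty (InvMultiset τ^[(n : ℕ)] wt 0 α) := ⟨fun s => h <| by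
          have h0 := Multiset.card_eq_zero.1 s.2.2.1
          have h1 := s.2.2.2
          rw [h0] at h1
          simpa using h1.symm⟩
        simp
    · have hwt' : ∀ y, wt (τ^[(n : ℕ)] y) = wt y := fun y =>
        (Function.Semiconj.iterate_right (f := wt) (ga := τ) (gb := id) hwt n y).trans
          (by rw [Function.iterate_id, id])
      have hB' : ∀ k δ, Finite (IterateFixed τ^[(n : ℕ)] wt (k + 1) δ) := by
        intro k δ
        by_cases h : ∃ β, δ = (k + 1) • β
        · obtain ⟨β, rfl⟩ := h
          have := hB (n * Nat.succPNat k) β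
          refine Finite.of_injective (β := {y // τ^[((n * Nat.succPNat k : ℕ+) : ℕ)] y = y ∧
            wt y = β}) (fun y => ⟨y.1, ?_, ?_⟩) fun y z h => Subtype.ext (congrArg (·.1) h)
          · rw [PNat.mul_coe, Nat.succPNat_coe, Function.iterate_mul]
            exact y.2.1
          · ext i
            simpa using DFunLike.congr_fun y.2.2 i
        · have : IsEmpty (IterateFixed τ^[(n : ℕ)] wt (k + 1) δ) :=
            ⟨fun y => h ⟨_, y.2.2.symm⟩⟩
          infer_instance
      have key := newton_invMultiset (hinj.iterate n) hwt' (hH n) hB' N α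
      rw [sigma]
      have hsmul : ∀ (r : ℚ) (f : MvPowerSeries ι (ℕ+ → ℚ)),
          MvPowerSeries.coeff α (r • f) n = r * MvPowerSeries.coeff α f n := fun _ _ => rfl
      rw [hsmul, map_sum, Finset.sum_apply, inv_mul_eq_iff_eq_mul₀ (by positivity)]
      have key' := congrArg (Nat.cast : ℕ → ℚ) key
      push_cast at key'
      rw [key']
      refine Finset.sum_congr rfl fun k _ => ?_
      rw [MvPowerSeries.coeff_mul, Finset.sum_apply]
      refine Finset.sum_congr rfl fun x _ => ?_
      rw [Pi.mul_apply, coeff_adamsPowerSeries ha, ih _ (by omega)]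

/-- Nonzero weights bound the cardinality of a multiset by the degree of its total weight. Hence
only `N ≤ α.degree` contributes, and the `finsum` is a finite sum over cardinalities. -/
theorem coeff_plethExp (hinj : Function.Injective τ) (hwt : ∀ y, wt (τ y) = wt y)
    (hwt0 : ∀ y, wt y ≠ 0)
    (ha : ∀ β (n : ℕ+), MvPowerSeries.coeff β a n =
      Nat.card {y // τ^[(n : ℕ)] y = y ∧ wt y = β})
    (hH : ∀ (n : ℕ+) α, Finite {s : Multiset Y // s.map τ^[(n : ℕ)] = s ∧ (s.map wt).sum = α})
    (α : ι →₀ ℕ) (n : ℕ+) : MvPowerSeries.coeff α (plethExp adamsFun a) n =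
      Nat.card {s : Multiset Y // s.map τ^[(n : ℕ)] = s ∧ (s.map wt).sum = α} := by
  have hH' : ∀ (n : ℕ+) N α, Finite (InvMultiset τ^[(n : ℕ)] wt N α) := fun n N α =>
    Finite.of_injective
      (β := {s : Multiset Y // s.map τ^[(n : ℕ)] = s ∧ (s.map wt).sum = α})
      (fun s => ⟨s.1, s.2.1, s.2.2.2⟩) fun s t h => Subtype.ext (congrArg (·.1) h)
  -- Fixed points are the invariant multisets with one element.
  have hB : ∀ (n : ℕ+) β, Finite {y // τ^[(n : ℕ)] y = y ∧ wt y = β} := fun n β =>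
    Finite.of_injective
      (β := {s : Multiset Y // s.map τ^[(n : ℕ)] = s ∧ (s.map wt).sum = β})
      (fun y => ⟨{y.1}, by simp [y.2.1], by simp [y.2.2]⟩) fun s t h =>
        Subtype.ext (Multiset.singleton_inj.1 (congrArg (·.1) h))
  have hdeg : ∀ s : Multiset Y, s.card ≤ (s.map wt).sum.degree := by
    intro s
    induction s using Multiset.induction_on with
    | empty => simp
    | cons y s ih =>
      have : (wt y).degree ≠ 0 := fun h => hwt0 y ((Finsupp.degree_eq_zero_iff _).1 h)
      simp only [Multiset.card_cons, Multiset.map_cons, Multiset.sum_cons, map_add]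
      omega
  have hsig := coeff_sigma hinj hwt ha hH' hB
  change (∑ᶠ N, MvPowerSeries.coeff α (sigma (adamsPowerSeries adamsFun) a N)) n = _
  rw [finsum_eq_sum_of_support_subset (s := Finset.range (α.degree + 1)), Finset.sum_apply]
  · simp only [hsig]
    rw [← Nat.cast_sum]
    congr 1
    rw [← Finset.sum_coe_sort (Finset.range (α.degree + 1)), ← Nat.card_sigma]
    refine Nat.card_congr
      { toFun := fun t => ⟨t.2.1, t.2.2.1, t.2.2.2.2⟩
        invFun := fun s => ⟨⟨s.1.card, Finset.mem_range.2 (Nat.lt_succ_of_le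
          ((hdeg s.1).trans_eq (by rw [s.2.2])))⟩, ⟨s.1, s.2.1, rfl, s.2.2⟩⟩
        left_inv := ?_
        right_inv := fun _ => rfl }
    rintro ⟨⟨N, hN⟩, ⟨s, h1, h2, h3⟩⟩
    obtain rfl : s.card = N := h2
    rfl
  · intro N hN
    rw [Finset.coe_range, Set.mem_Iio]
    by_contra hlt
    refine hN (funext fun n => ?_)
    change MvPowerSeries.coeff α (sigma (adamsPowerSeries adamsFun) a N) n = 0
    rw [hsig]
    have : IsEmpty (InvMultiset τ^[(n : ℕ)] wt N α) := ⟨fun s => by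
      have := hdeg s.1
      rw [s.2.2.1, s.2.2.2] at this
      omega⟩
    simp

end PlethExp

/-! ### Counting representations over finite fields -/

namespace QuiverRep

open IsoClass

variable {Q : Type u} [Quiver.{v} Q] [Fintype Q] [DecidableEq Q]

section Descent

variable (K : Type*) [Field K] [Fintype K] (L : Type*) [Field L] [IsAlgClosed L] [Algebra K L]
  [Algebra.IsAlgebraic K L]

/-- Any two algebraic closures of `K` are isomorphic over `K`, and a field isomorphism preserves
indecomposability. The closure can therefore be chosen freely. -/
theorem isAbsIndecomposable_iff {K : Type*} [Field K] (L : Type*) [Field L] [IsAlgClosed L]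
    [Algebra K L] [Algebra.IsAlgebraic K L] {α : Q → ℕ} (M : QuiverRep Q K α) :
    M.IsAbsIndecomposable ↔ IsIndec (IsoClass.map (algebraMap K L) (mk M)) := by
  have : IsAlgClosure K L := ⟨inferInstance, inferInstance⟩
  let e := IsAlgClosure.equiv K (AlgebraicClosure K) L
  have h : IsoClass.map (algebraMap K L) (mk M) =
      IsoClass.mapEquiv e.toRingEquiv (mk (M.baseChange (AlgebraicClosure K))) := by
    rw [IsoClass.mapEquiv_apply]
    change IsoClass.mk _ = IsoClass.mk ((M.mapRep (algebraMap K (AlgebraicClosure K))).mapRep _)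
    rw [mapRep_mapRep]
    congr 2
    exact e.toAlgHom.comp_algebraMap.symm
  rw [h, AddEquiv.isIndec_iff, isIndec_mk_iff]
  rfl

/-- Isomorphism classes over a finite field are the isomorphism classes over an algebraic closure
which are fixed by the Frobenius map. -/
noncomputable def descentEquiv (α : Q → ℕ) : Quotient (isoSetoid Q K α) ≃
    {x : IsoClass Q L //
      IsoClass.map (FiniteField.frobeniusAlgHom K L).toRingHom x = x ∧ dim x = α} :=
  Equiv.ofBijective
    (Quotient.lift (fun M => ⟨IsoClass.map (algebraMap K L) (mk M),
      (mem_range_map_iff K _).1 ⟨_, rfl⟩, by simp⟩) fun M N h => Subtype.ext <| by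
        change IsoClass.map _ _ = IsoClass.map _ _
        rw [mk_eq_mk_iff.2 h]) <| by
    constructor
    · intro x y
      refine Quotient.inductionOn₂ x y fun M N h => Quotient.sound ?_
      exact mk_eq_mk_iff.1 (map_algebraMap_injective (L := L) (congrArg Subtype.val h))
    · rintro ⟨x, hx, hα⟩
      obtain ⟨y, rfl⟩ := (mem_range_map_iff K x).2 hx
      rw [dim_map] at hα
      obtain ⟨M, rfl⟩ := exists_mk_of_dim hα
      exact ⟨Quotient.mk _ M, rfl⟩

theorem descentEquiv_mk {α : Q → ℕ} (M : QuiverRep Q K α) :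
    (descentEquiv K L α (Quotient.mk (isoSetoid Q K α) M) : IsoClass Q L) =
      IsoClass.map (algebraMap K L) (mk M) := rfl

theorem numReps_eq_card (α : Q → ℕ) : numReps Q K α = Nat.card
    {x : IsoClass Q L //
      IsoClass.map (FiniteField.frobeniusAlgHom K L).toRingHom x = x ∧ dim x = α} :=
  Nat.card_congr (descentEquiv K L α)

theorem numAbsIndec_eq_card (α : Q → ℕ) : numAbsIndec Q K α = Nat.card
    {x : {x : IsoClass Q L //
      IsoClass.map (FiniteField.frobeniusAlgHom K L).toRingHom x = x ∧ dim x = α} // IsIndec x.1} :=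
  Nat.card_congr <| (descentEquiv K L α).subtypeEquiv fun c => by
    refine Quotient.inductionOn c fun M => ?_
    rw [descentEquiv_mk, ← isAbsIndecomposable_iff]
    constructor
    · rintro ⟨N, hN, h⟩
      rw [isAbsIndecomposable_iff L] at h ⊢
      rwa [mk_eq_mk_iff.2 (Quotient.exact hN)] at h
    · exact fun h => ⟨M, rfl, h⟩

theorem finite_fixed [∀ i j : Q, Finite (i ⟶ j)] (α : Q → ℕ) : Finite
    {x : IsoClass Q L //
      IsoClass.map (FiniteField.frobeniusAlgHom K L).toRingHom x = x ∧ dim x = α} := by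
  have : Finite (QuiverRep Q K α) :=
    inferInstanceAs (Finite (∀ i j : Q, (i ⟶ j) → Matrix (Fin (α j)) (Fin (α i)) K))
  exact Finite.of_equiv _ (descentEquiv K L α)

end Descent

section Frobenius

variable (Q) (p : ℕ) [Fact p.Prime] (L : Type*) [Field L] [CharP L p]

/-- The Frobenius map on isomorphism classes. -/
noncomputable def frobeniusMap [PerfectRing L p] : IsoClass Q L ≃+ IsoClass Q L :=
  IsoClass.mapEquiv (frobeniusEquiv L p)

variable {Q L}

theorem map_iterateFrobenius [PerfectRing L p] (n : ℕ) (x : IsoClass Q L) :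
    IsoClass.map (iterateFrobenius L p n) x = (frobeniusMap Q p L)^[n] x := by
  induction n with
  | zero =>
    rw [iterateFrobenius_zero, IsoClass.map_id]
    rfl
  | succ n ih =>
    rw [Function.iterate_succ_apply', ← ih, frobeniusMap, IsoClass.mapEquiv_apply, IsoClass.map_map]
    congr 2
    ext c
    simp [iterateFrobenius_def, frobenius_def, pow_succ, pow_mul, pow_right_comm]

variable (Q L)

/-- The Frobenius map on isomorphism classes of indecomposable representations. -/
noncomputable def frobeniusIndec [PerfectRing L p] (y : {y : IsoClass Q L // IsIndec y}) :
    {y : IsoClass Q L // IsIndec y} :=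
  ⟨frobeniusMap Q p L y.1, (AddEquiv.isIndec_iff _).2 y.2⟩

/-- The dimension vector of an indecomposable representation. -/
noncomputable def weight (y : {y : IsoClass Q L // IsIndec y}) : Q →₀ ℕ :=
  Finsupp.equivFunOnFinite.symm (dim y.1)

variable {Q L}

theorem frobeniusIndec_injective [PerfectRing L p] :
    Function.Injective (frobeniusIndec Q p L) := fun _ _ h =>
  Subtype.ext ((frobeniusMap Q p L).injective (congrArg Subtype.val h))

theorem coe_iterate_frobeniusIndec [PerfectRing L p] (n : ℕ)
    (y : {y : IsoClass Q L // IsIndec y}) :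
    ((frobeniusIndec Q p L)^[n] y).1 = (frobeniusMap Q p L)^[n] y.1 := by
  induction n with
  | zero => rfl
  | succ n ih => rw [Function.iterate_succ_apply', Function.iterate_succ_apply', ← ih]; rfl

theorem weight_frobeniusIndec [PerfectRing L p] (y : {y : IsoClass Q L // IsIndec y}) :
    weight Q L (frobeniusIndec Q p L y) = weight Q L y :=
  congrArg Finsupp.equivFunOnFinite.symm (dim_map _ y.1)

theorem weight_ne_zero (y : {y : IsoClass Q L // IsIndec y}) : weight Q L y ≠ 0 := fun h =>
  y.2.1 <| eq_zero_of_dim <| funext fun i => DFunLike.congr_fun h i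

theorem coe_sum_weight (s : Multiset {y : IsoClass Q L // IsIndec y}) :
    ⇑(s.map (weight Q L)).sum = dim (s.map Subtype.val).sum := by
  induction s using Multiset.induction_on with
  | empty => simp
  | cons y s ih =>
    simp only [Multiset.map_cons, Multiset.sum_cons, Finsupp.coe_add, ih, map_add]
    rfl

theorem iterate_frobeniusMap_sum [PerfectRing L p] (n : ℕ)
    (s : Multiset {y : IsoClass Q L // IsIndec y}) :
    (frobeniusMap Q p L)^[n] (s.map Subtype.val).sum =
      ((s.map (frobeniusIndec Q p L)^[n]).map Subtype.val).sum := by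
  induction s using Multiset.induction_on with
  | empty => simp
  | cons y s ih =>
    simp only [Multiset.map_cons, Multiset.sum_cons, iterate_map_add, ih,
      coe_iterate_frobeniusIndec]

variable (Q L)

/-- The isomorphism classes fixed by an iterate of the Frobenius map are the multisets of
isomorphism classes of indecomposable representations with the same property. -/
noncomputable def fixedEquiv [PerfectRing L p] (n : ℕ) (α : Q →₀ ℕ) :
    {s : Multiset {y : IsoClass Q L // IsIndec y} //
      s.map (frobeniusIndec Q p L)^[n] = s ∧ (s.map (weight Q L)).sum = α} ≃
    {x : IsoClass Q L // (frobeniusMap Q p L)^[n] x = x ∧ dim x = α} :=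
  (Equiv.ofBijective _ (bijective_sum Q L)).subtypeEquiv fun s => by
    refine and_congr ?_ ?_
    · rw [Equiv.ofBijective_apply, iterate_frobeniusMap_sum]
      exact (bijective_sum Q L).1.eq_iff.symm
    · rw [Equiv.ofBijective_apply, ← coe_sum_weight, DFunLike.coe_fn_eq]

end Frobenius

section GaloisField

variable (Q) (p : ℕ) [Fact p.Prime]

/-- The field has `p ^ n` elements, so its relative Frobenius is the `n`-th iterate of the absolute
one. -/
theorem map_frobeniusAlgHom_galoisField {L : Type*} [Field L] [CharP L p] [PerfectRing L p]
    (n : ℕ+) [Fintype (GaloisField p n)] [Algebra (GaloisField p n) L] (x : IsoClass Q L) :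
    IsoClass.map (FiniteField.frobeniusAlgHom (GaloisField p n) L).toRingHom x =
      (frobeniusMap Q p L)^[n] x := by
  rw [← map_iterateFrobenius]
  congr 2
  ext c
  have : Fintype.card (GaloisField p n) = p ^ (n : ℕ) := by
    rw [← Nat.card_eq_fintype_card, GaloisField.card p n n.ne_zero]
  simp [iterateFrobenius_def, this]

/-- Counting over `GaloisField p n` in terms of the Frobenius map over the algebraic closure of
the prime field. -/
theorem count_galoisField [∀ i j : Q, Finite (i ⟶ j)] (n : ℕ+) (α : Q →₀ ℕ) :
    let L := AlgebraicClosure (ZMod p)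
    numReps Q (GaloisField p n) α = Nat.card {s : Multiset {y : IsoClass Q L // IsIndec y} //
      s.map (frobeniusIndec Q p L)^[(n : ℕ)] = s ∧ (s.map (weight Q L)).sum = α} ∧
    Finite {s : Multiset {y : IsoClass Q L // IsIndec y} //
      s.map (frobeniusIndec Q p L)^[(n : ℕ)] = s ∧ (s.map (weight Q L)).sum = α} ∧
    numAbsIndec Q (GaloisField p n) α = Nat.card {y : {y : IsoClass Q L // IsIndec y} //
      (frobeniusIndec Q p L)^[(n : ℕ)] y = y ∧ weight Q L y = α} := by
  intro L
  have := Fintype.ofFinite (GaloisField p n)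
  -- All the fields `GaloisField p n` are embedded in the same `L`, so that iterates of one map
  -- describe every `n`.
  let i : GaloisField p n →ₐ[ZMod p] L := IsAlgClosed.lift
  let _ := i.toRingHom.toAlgebra
  have : IsScalarTower (ZMod p) (GaloisField p n) L :=
    IsScalarTower.of_algebraMap_eq fun x => (i.commutes x).symm
  have : Algebra.IsAlgebraic (GaloisField p n) L :=
    Algebra.IsAlgebraic.tower_top (K := ZMod p) (GaloisField p n)
  let e : {x : IsoClass Q L //
      IsoClass.map (FiniteField.frobeniusAlgHom (GaloisField p n) L).toRingHom x = x ∧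
        dim x = α} ≃ {x : IsoClass Q L // (frobeniusMap Q p L)^[(n : ℕ)] x = x ∧ dim x = α} :=
    Equiv.subtypeEquivRight fun x => by rw [map_frobeniusAlgHom_galoisField]
  refine ⟨?_, ?_, ?_⟩
  · rw [numReps_eq_card _ L]
    exact Nat.card_congr (e.trans (fixedEquiv Q p L n α).symm)
  · have := finite_fixed (GaloisField p n) L α
    exact Finite.of_equiv _ (e.trans (fixedEquiv Q p L n α).symm)
  · rw [numAbsIndec_eq_card _ L]
    refine Nat.card_congr
      { toFun := fun x => ⟨⟨x.1.1, x.2⟩, ?_, ?_⟩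
        invFun := fun y => ⟨⟨y.1.1, ?_, ?_⟩, y.1.2⟩
        left_inv := fun _ => rfl
        right_inv := fun _ => rfl }
    · refine Subtype.ext ?_
      rw [coe_iterate_frobeniusIndec]
      exact (e x.1).2.1
    · exact DFunLike.coe_injective x.1.2.2
    · rw [map_frobeniusAlgHom_galoisField, ← coe_iterate_frobeniusIndec, y.2.1]
    · exact congrArg DFunLike.coe y.2.2

theorem constantCoeff_absIndecCountSeries [∀ i j : Q, Finite (i ⟶ j)] :
    MvPowerSeries.constantCoeff (absIndecCountSeries Q p) = 0 := by
  funext n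
  change ((numAbsIndec Q (GaloisField p n) (0 : Q →₀ ℕ) : ℕ) : ℚ) = 0
  rw [(count_galoisField Q p n 0).2.2]
  have : IsEmpty {y : {y : IsoClass Q (AlgebraicClosure (ZMod p)) // IsIndec y} //
      (frobeniusIndec Q p (AlgebraicClosure (ZMod p)))^[(n : ℕ)] y = y ∧
        weight Q (AlgebraicClosure (ZMod p)) y = 0} :=
    ⟨fun y => weight_ne_zero _ y.2.2⟩
  simp

theorem repCountSeries_eq_plethExp [∀ i j : Q, Finite (i ⟶ j)] :
    repCountSeries Q p = LambdaRing.plethExp LambdaRing.adamsFun (absIndecCountSeries Q p) := by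
  classical
  ext α n
  rw [coeff_plethExp (a := absIndecCountSeries Q p) (frobeniusIndec_injective p)
    (weight_frobeniusIndec p) weight_ne_zero
    (fun β n => congrArg Nat.cast (count_galoisField Q p n β).2.2)
    fun n α => (count_galoisField Q p n α).2.1]
  exact congrArg Nat.cast (count_galoisField Q p n α).1

end GaloisField

end QuiverRep

/-! ### Naturality of the plethystic exponential -/

namespace LambdaRing

section Naturality

variable {ι R S : Type*} [CommRing R] [Algebra ℚ R] [CommRing S] [Algebra ℚ S]
  {ψ : ℕ+ →* (R →+* R)} {ψ' : ℕ+ →* (S →+* S)} {φ : R →+* S}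

theorem map_sigma (h : ∀ n r, φ (ψ n r) = ψ' n (φ r)) (r : R) (N : ℕ) :
    φ (sigma ψ r N) = sigma ψ' (φ r) N := by
  induction N using Nat.strong_induction_on with
  | _ N ih =>
    rcases N with _ | N
    · rw [sigma, sigma, map_one]
    · rw [sigma, sigma, map_rat_smul, map_sum]
      congr 1
      refine Finset.sum_congr rfl fun k _ => ?_
      rw [map_mul, h, ih _ (by omega)]

theorem map_adamsPowerSeries (h : ∀ n r, φ (ψ n r) = ψ' n (φ r)) (n : ℕ+)
    (f : MvPowerSeries ι R) : MvPowerSeries.map φ (adamsPowerSeries ψ n f) =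
      adamsPowerSeries ψ' n (MvPowerSeries.map φ f) := by
  have hc : φ.comp (ψ n) = (ψ' n).comp φ := RingHom.ext (h n)
  change MvPowerSeries.map φ (MvPowerSeries.map (ψ n) (MvPowerSeries.expand n n.ne_zero f)) =
    MvPowerSeries.map (ψ' n) (MvPowerSeries.expand n n.ne_zero (MvPowerSeries.map φ f))
  rw [← MvPowerSeries.map_expand, ← RingHom.comp_apply, ← RingHom.comp_apply,
    ← MvPowerSeries.map_comp, ← MvPowerSeries.map_comp, hc]

/-- Injectivity of `φ` lets it commute with the `finsum` without any knowledge of the supports. -/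
theorem map_plethExp (hφ : Function.Injective φ) (h : ∀ n r, φ (ψ n r) = ψ' n (φ r))
    (f : MvPowerSeries ι R) :
    MvPowerSeries.map φ (plethExp ψ f) = plethExp ψ' (MvPowerSeries.map φ f) := by
  ext d
  rw [MvPowerSeries.coeff_map]
  change φ (∑ᶠ n, MvPowerSeries.coeff d (sigma (adamsPowerSeries ψ) f n)) =
    ∑ᶠ n, MvPowerSeries.coeff d (sigma (adamsPowerSeries ψ') (MvPowerSeries.map φ f) n)
  have := AddMonoidHom.map_finsum_of_injective φ.toAddMonoidHom hφ
    fun n => MvPowerSeries.coeff d (sigma (adamsPowerSeries ψ) f n)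
  refine this.trans (finsum_congr fun n => ?_)
  rw [← map_sigma (map_adamsPowerSeries h), MvPowerSeries.coeff_map]
  rfl

end Naturality

/-- The Adams operations on polynomials: `ψ n (f(q)) = f(q^n)`. -/
noncomputable def adamsPoly : ℕ+ →* (ℚ[X] →+* ℚ[X]) where
  toFun n := (expand ℚ (n : ℕ) : ℚ[X] →+* ℚ[X])
  map_one' := by
    refine RingHom.ext fun f => ?_
    simp
  map_mul' m n := by
    refine RingHom.ext fun f => ?_
    simp [expand_mul]

/-- The values of a polynomial at the powers `p ^ n`. -/
noncomputable def evalPow (p : ℕ) : ℚ[X] →+* (ℕ+ → ℚ) :=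
  RingHom.pi fun n => evalRingHom ((p : ℚ) ^ (n : ℕ))

theorem evalPow_apply (p : ℕ) (f : ℚ[X]) (n : ℕ+) :
    evalPow p f n = f.eval ((p : ℚ) ^ (n : ℕ)) := rfl

theorem evalPow_adamsPoly (p : ℕ) (n : ℕ+) (f : ℚ[X]) :
    evalPow p (adamsPoly n f) = adamsFun n (evalPow p f) := by
  funext k
  change (expand ℚ (n : ℕ) f).eval _ = f.eval _
  rw [expand_eval, ← pow_mul, PNat.mul_coe, mul_comm]

theorem evalPow_injective {p : ℕ} (hp : 1 < p) : Function.Injective (evalPow p) := by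
  intro f g h
  refine eq_of_infinite_eval_eq f g (Set.infinite_of_injective_forall_mem
    (f := fun n : ℕ+ => (p : ℚ) ^ (n : ℕ)) (fun m n hmn => ?_) fun n => congrFun h n)
  have hmn : (p : ℚ) ^ (m : ℕ) = (p : ℚ) ^ (n : ℕ) := hmn
  have : p ^ (m : ℕ) = p ^ (n : ℕ) := by exact_mod_cast hmn
  exact PNat.coe_injective (Nat.pow_right_injective hp this)

end LambdaRing

/-! ### The plethystic identity for functions and for polynomials -/

theorem mainTheorem3 {Q : Type u} [Quiver.{v} Q] [Finite Q] [∀ i j : Q, Finite (i ⟶ j)] :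
    (∀ (p : ℕ) [Fact p.Prime],
      MvPowerSeries.constantCoeff (absIndecCountSeries Q p) = 0 ∧
      repCountSeries Q p = LambdaRing.plethExp LambdaRing.adamsFun (absIndecCountSeries Q p)) ∧
    (∀ m a : (Q →₀ ℕ) → ℚ[X],
      (∀ α, IsRepCountPoly Q α (m α)) → (∀ α, IsAbsIndecCountPoly Q α (a α)) →
      MvPowerSeries.constantCoeff (polySeries a) = 0 ∧
      polySeries m = LambdaRing.plethExp LambdaRing.adamsRatFunc (polySeries a)) := by
  classical
  have := Fintype.ofFinite Q
  refine ⟨fun p _ => ⟨QuiverRep.constantCoeff_absIndecCountSeries Q p,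
    QuiverRep.repCountSeries_eq_plethExp Q p⟩, fun m a hm ha => ?_⟩
  -- One prime suffices: a polynomial over ℚ is determined by its values at the powers of `2`.
  have : Fact (Nat.Prime 2) := ⟨Nat.prime_two⟩
  let m' : MvPowerSeries Q ℚ[X] := m
  let a' : MvPowerSeries Q ℚ[X] := a
  have hev {P : ℚ[X]} {f : ℕ+ → ℚ}
      (h : ∀ n : ℕ+, P.eval (Nat.card (GaloisField 2 n) : ℚ) = f n) :
      LambdaRing.evalPow 2 P = f := by
    funext n
    rw [LambdaRing.evalPow_apply, ← h n, GaloisField.card 2 n n.ne_zero]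
    push_cast
    rfl
  have hfin : ∀ n, Finite (GaloisField 2 n) := fun n => inferInstance
  have hm' : MvPowerSeries.map (LambdaRing.evalPow 2) m' = repCountSeries Q 2 := by
    ext1 α
    exact hev fun n => hm α (GaloisField 2 n)
  have ha' : MvPowerSeries.map (LambdaRing.evalPow 2) a' = absIndecCountSeries Q 2 := by
    ext1 α
    exact hev fun n => ha α (GaloisField 2 n)
  have hinj := LambdaRing.evalPow_injective one_lt_two
  have h0 : a 0 = 0 := by
    apply hinj
    rw [map_zero]
    exact (congrArg (MvPowerSeries.coeff 0) ha').trans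
      (QuiverRep.constantCoeff_absIndecCountSeries Q 2)
  -- Evaluation respects Adams operations, so the identity of counting functions is the image of one
  -- over `ℚ[X]`, and evaluation is injective.
  have h1 : m' = LambdaRing.plethExp LambdaRing.adamsPoly a' := by
    have h := QuiverRep.repCountSeries_eq_plethExp Q 2
    rw [← hm', ← ha', ← LambdaRing.map_plethExp hinj (LambdaRing.evalPow_adamsPoly 2)] at h
    ext1 α
    exact hinj (congrArg (MvPowerSeries.coeff α) h)
  refine ⟨?_, ?_⟩
  · change algebraMap ℚ[X] (RatFunc ℚ) (a 0) = 0
    rw [h0, map_zero]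
  · have h := congrArg (MvPowerSeries.map (algebraMap ℚ[X] (RatFunc ℚ))) h1
    rw [LambdaRing.map_plethExp (ψ' := LambdaRing.adamsRatFunc) (IsFractionRing.injective _ _)
      fun n f => (LambdaRing.ratFuncExpand_algebraMap n f).symm] at h
    exact h
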